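/- **Setting.** Let $\mathcal X\subset\mathbb R^d$ be closed, convex and bounded, with Euclidean diameter $D$; let $f:\mathcal X\to\mathbb R$ be convex, $x_0\in\mathcal X$, and let $\mathcal X\supseteq S_1\supseteq S_2\supseteq\dots\supseteq S_T$ be nonempty closed convex sets. Write $v_t=\min_{S_t}f$, $\mathbf X_t^*=\arg\min_{S_t}f$, and $\Pi_S$ for Euclidean projection onto $S$. For $\alpha>0$, $f$ is called $\alpha$-sharp over $S$ if $f(x)-\min_S f\ge\alpha\,\mathrm{dist}(x,\arg\min_S f)$ for all $x\in S$. The online algorithm FRUGAL starts with $x_0$ and $F_0=0$. At time $t=1,\dots,T$ it plays the lazy action $x_t=\Pi_{S_t}(x_{t-1})$ if $F_{t-1}+f(\Pi_{S_t}(x_{t-1}))\le t\,v_t$; otherwise it *jumps* to the nearest minimizer, $x_t=\Pi_{\mathbf X_t^*}(x_{t-1})$. It then sets $F_t=F_{t-1}+f(x_t)$. Its movement cost is $M(T)=\sum_{t=1}^T\|x_t-x_{t-1}\|_2$. **Theorem.** Suppose that $f$ is $G$-Lipschitz on $\mathcal X$ and $\alpha$-sharp over each of $S_1,\dots,S_T$.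 1. There is an absolute constant $C$ (independent of $d,\mathcal X,f,(S_t),x_0,T,G,\alpha$) such that, whenever $0<\alpha\le G$ and $T\ge2$, $$M(T)\le C\,d^{d/2}\,D\,\log_{1+\alpha/G}T\qquad(\text{with }0^0=1).$$ 2. Consequently $M(T)=O(\log T)$: for all $d$, $D$, $G$ and $\alpha>0$ there is a constant $C'$, depending on these only, such that $M(T)\le C'\log T$ for every such instance with $T\ge 2$ and $\mathrm{diam}\,\mathcal X\le D$. 3. If, in addition, $0<\alpha\le G$, $T\ge1$ and the minimizer of $f$ over $S_t$ is unique for every $t\le T$, then any two jump times $s<t$ satisfy $t>(1+\alpha/G)\,s$, and the number of jumps up to time $T$ is at most $\lceil G/\alpha\rceil+1+\log_{1+\alpha/G}T$. -/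

import Mathlib

open scoped NNReal

namespace CONES

/-- Euclidean `d`-space, with the 2-norm. -/
abbrev Space (d : ℕ) : Type := EuclideanSpace ℝ (Fin d)

variable {d : ℕ}

/-- The set of minimizers of `f` over `S`. -/
def argminSet (f : Space d → ℝ) (S : Set (Space d)) : Set (Space d) :=
  {x | x ∈ S ∧ ∀ y ∈ S, f x ≤ f y}

/-- The minimum value of `f` over `S` (used only where the minimum is attained). -/
noncomputable def minValue (f : Space d → ℝ) (S : Set (Space d)) : ℝ :=
  sInf (f '' S)

/-- `f` is `α`-sharp over `S`: its excess over the minimum value on `S` is at least `α` times the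
distance to the set of minimizers over `S`. -/
def IsSharpOn (α : ℝ) (f : Space d → ℝ) (S : Set (Space d)) : Prop :=
  0 < α ∧ ∀ x ∈ S, α * Metric.infDist x (argminSet f S) ≤ f x - minValue f S

open Classical in
/-- Euclidean projection: the point of `S` nearest to `x`. For nonempty closed convex `S` it exists
and is unique (`proj_mem`, `dist_proj_le`, `eq_proj`); the value `x` when there is no nearest point
is never used. -/
noncomputable def proj (S : Set (Space d)) (x : Space d) : Space d :=
  if h : ∃ p ∈ S, ∀ y ∈ S, dist x p ≤ dist x y then h.choose else x

theorem exists_nearest {S : Set (Space d)} (hne : S.Nonempty) (hcl : IsClosed S) (x : Space d) :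
    ∃ p ∈ S, ∀ y ∈ S, dist x p ≤ dist x y := by
  obtain ⟨p, hp, h⟩ := hcl.exists_infDist_eq_dist hne x
  exact ⟨p, hp, fun y hy => h ▸ Metric.infDist_le_dist_of_mem hy⟩

theorem proj_mem {S : Set (Space d)} (hne : S.Nonempty) (hcl : IsClosed S) (x : Space d) :
    proj S x ∈ S := by
  have h := exists_nearest hne hcl x
  rw [proj, dif_pos h]
  exact h.choose_spec.1

theorem dist_proj_le {S : Set (Space d)} (hne : S.Nonempty) (hcl : IsClosed S) (x : Space d)
    {y : Space d} (hy : y ∈ S) : dist x (proj S x) ≤ dist x y := by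
  have h := exists_nearest hne hcl x
  rw [proj, dif_pos h]
  exact h.choose_spec.2 y hy

theorem eq_proj {S : Set (Space d)} (hcl : IsClosed S) (hcv : Convex ℝ S) (x : Space d)
    {p : Space d} (hp : p ∈ S) (hmin : ∀ y ∈ S, dist x p ≤ dist x y) : p = proj S x := by
  have hne : S.Nonempty := ⟨p, hp⟩
  have hq := proj_mem hne hcl x
  have h1 := hmin _ hq
  have h2 := dist_proj_le hne hcl x hp
  have hm : midpoint ℝ p (proj S x) ∈ S := hcv.midpoint_mem hp hq
  have h3 := hmin _ hm
  by_contra hne'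
  have hpq : x - p ≠ x - proj S x := fun h => hne' (sub_right_injective h)
  have hlt := (norm_midpoint_lt_iff (x := x - p) (y := x - proj S x)
    (by rw [← dist_eq_norm, ← dist_eq_norm]; exact le_antisymm h1 h2)).2 hpq
  rw [dist_eq_norm, dist_eq_norm] at h3
  have he : x - midpoint ℝ p (proj S x) = (1 / 2 : ℝ) • ((x - p) + (x - proj S x)) := by
    rw [midpoint_eq_smul_add, invOf_eq_inv]
    module
  rw [he] at h3
  exact absurd hlt (not_lt.2 h3)

/-- FRUGAL's test at time `t`: with previous action `x` and accumulated cost `F`, the lazy action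
(projecting `x` onto `S t`) keeps the accumulated cost at most `t` times the minimum over `S t`. -/
def LazyOK (f : Space d → ℝ) (S : ℕ → Set (Space d)) (t : ℕ) (x : Space d) (F : ℝ) : Prop :=
  F + f (proj (S t) x) ≤ t * minValue f (S t)

open Classical in
/-- FRUGAL's action at time `t`, given the previous action `x` and the accumulated cost `F`: the
lazy action if the test allows it, and else a jump to the minimizer over `S t` nearest to `x`. -/
noncomputable def frugalStep (f : Space d → ℝ) (S : ℕ → Set (Space d)) (t : ℕ)
    (x : Space d) (F : ℝ) : Space d :=
  if LazyOK f S t x F then proj (S t) x else proj (argminSet f (S t)) x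

/-- The pair `(x_t, F_t)` of FRUGAL's action and accumulated cost after round `t`. -/
noncomputable def frugalState (f : Space d → ℝ) (S : ℕ → Set (Space d)) (x₀ : Space d) :
    ℕ → Space d × ℝ
  | 0 => (x₀, 0)
  | t + 1 =>
    let p := frugalState f S x₀ t
    let x := frugalStep f S (t + 1) p.1 p.2
    (x, p.2 + f x)

/-- The action sequence of FRUGAL started at `x₀`. -/
noncomputable def frugal (f : Space d → ℝ) (S : ℕ → Set (Space d)) (x₀ : Space d) (t : ℕ) :
    Space d :=
  (frugalState f S x₀ t).1

/-- The times in `{1, …, T}` at which FRUGAL jumps, that is, does not play the lazy action. -/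
def frugalJumps (f : Space d → ℝ) (S : ℕ → Set (Space d)) (x₀ : Space d) (T : ℕ) : Set ℕ :=
  {t | 1 ≤ t ∧ t ≤ T ∧
    ¬ LazyOK f S t (frugalState f S x₀ (t - 1)).1 (frugalState f S x₀ (t - 1)).2}

/-- The movement cost `∑_{t=1}^T ‖x_t - x_{t-1}‖`. -/
noncomputable def movementCost (x : ℕ → Space d) (T : ℕ) : ℝ :=
  ∑ t ∈ Finset.Icc 1 T, ‖x t - x (t - 1)‖

/-- An instance of convex optimization with nested evolving feasible sets with horizon `T`. Only the
values `S t` with `1 ≤ t ≤ T` and those of `f` on `X` matter. -/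
structure IsInstance (X : Set (Space d)) (f : Space d → ℝ) (S : ℕ → Set (Space d))
    (x₀ : Space d) (T : ℕ) : Prop where
  isClosed_X : IsClosed X
  convex_X : Convex ℝ X
  isBounded_X : Bornology.IsBounded X
  convexOn_f : ConvexOn ℝ X f
  start_mem : x₀ ∈ X
  nonempty_S : ∀ t, 1 ≤ t → t ≤ T → (S t).Nonempty
  isClosed_S : ∀ t, 1 ≤ t → t ≤ T → IsClosed (S t)
  convex_S : ∀ t, 1 ≤ t → t ≤ T → Convex ℝ (S t)
  first_subset : S 1 ⊆ X
  nested_S : ∀ t, 1 ≤ t → t < T → S (t + 1) ⊆ S t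

/-- `f` is `G`-Lipschitz on `X` and `α`-sharp, with the same `α`, over each of `S 1, …, S T`. -/
structure IsLipschitzSharp (G : ℝ≥0) (α : ℝ) (X : Set (Space d)) (f : Space d → ℝ)
    (S : ℕ → Set (Space d)) (T : ℕ) : Prop where
  lipschitz : LipschitzOnWith G f X
  sharp : ∀ t, 1 ≤ t → t ≤ T → IsSharpOn α f (S t)

end CONES

/-! Group the jumps into phases: a phase opens at a jump time s and contains the later jumps at
times t ≤ (1 + εα/G)s, with ε = `tolerance d`. Opening times grow geometrically, so there are
logarithmically many phases, and it suffices to bound the movement in one phase by a constant times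
the diameter.

A jump at t+1 with previous jump s means that lazy play overspent in between. Projections never move
away from points that remain feasible, so the overspending gives s(v_{t+1} - v_s) < (t+1-s) G ‖x_s -
x_{t+1}‖ (`mul_minValue_sub_lt`). Within a phase the minimum value therefore grows by at most εα per
unit of length travelled by the jump points. Sharpness turns this into distance: a later jump point
lies within ε times that length of each earlier minimizer set of the phase. Projecting onto such a
set then almost decreases the distance to the later jump points, so these form an almost
self-contracted polygonal line (`norm_jumpPoint_sub_sq_le`). The lazy stretches between jumps are
self-contracted exactly.

The geometric core is `pathLength_le`: such a line is no longer than a constant times the distance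
of its end points. Each vertex sees the later ones under almost acute angles, so the directions
uniformly positive on all of them fill at least a fraction 18^{-d} of the unit ball
(`volume_setOf_inner_ge`). Deleting the vertex lowers the mean support function of the tail in
proportion to the step, and the drops telescope. All constants are exponential in d, hence
O(d^{d/2}).

If minimizers are unique, sharpness at the previous jump J gives α‖x_J - x_{t+1}‖ ≤ v_{t+1} - v_J.
The same inequality then yields (1 + α/G)J < t+1 directly. -/

namespace CONES

open MeasureTheory Metric
open scoped RealInnerProductSpace ENNReal Pointwise

/-! ### Almost acute families of unit vectors and the volume of their dual cones -/

/-- The point of a complete convex set nearest to `x`, by its variational inequality. -/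
theorem exists_inner_sub_le_zero {E : Type*} [NormedAddCommGroup E] [InnerProductSpace ℝ E]
    {K : Set E} (hne : K.Nonempty) (hc : IsComplete K) (hK : Convex ℝ K) (x : E) :
    ∃ a ∈ K, ∀ w ∈ K, ⟪x - a, w - a⟫ ≤ 0 := by
  obtain ⟨a, ha, h⟩ := exists_norm_eq_iInf_of_complete_convex hne hc hK x
  exact ⟨a, ha, (norm_eq_iInf_iff_real_inner_le_zero hK ha).1 h⟩

/-- Finitely many unit vectors with pairwise almost nonnegative inner products lie in a common
half-space, quantitatively. -/
theorem exists_inner_ge_of_pairwise {d : ℕ} {U : Finset (Space d)} (hU : U.Nonempty) {r : ℝ}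
    (h1 : ∀ u ∈ U, ‖u‖ = 1) (hr : r ≤ 1 / (2 * ((d : ℝ) + 1))) (hr0 : 0 ≤ r)
    (hp : ∀ u ∈ U, ∀ w ∈ U, -r ≤ ⟪u, w⟫) :
    ∃ p : Space d, ‖p‖ ≤ 1 ∧ 1 / (2 * ((d : ℝ) + 1)) ≤ ‖p‖ ^ 2 ∧
      ∀ u ∈ U, ‖p‖ ^ 2 ≤ ⟪p, u⟫ := by
  have hcomp : IsCompact (convexHull ℝ (U : Set (Space d))) :=
    U.finite_toSet.isCompact_convexHull ℝ
  obtain ⟨p, hpm, hvar⟩ := exists_inner_sub_le_zero (x := (0 : Space d))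
    (convexHull_nonempty_iff.2 (Finset.coe_nonempty.2 hU)) hcomp.isComplete (convex_convexHull ℝ _)
  have hin : ∀ u ∈ U, ‖p‖ ^ 2 ≤ ⟪p, u⟫ := by
    intro u hu
    have := hvar u (subset_convexHull ℝ _ hu)
    rw [zero_sub, inner_neg_left, inner_sub_right, real_inner_self_eq_norm_sq] at this
    linarith
  refine ⟨p, ?_, ?_, hin⟩
  · obtain ⟨u, hu⟩ := hU
    have h2 := hin u hu
    have h3 := real_inner_le_norm p u
    rw [h1 u hu, mul_one] at h3
    by_contra hlt
    push Not at hlt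
    nlinarith
  -- Carathéodory: at most d+1 of the vectors represent p, so ∑ w² ≥ 1/(d+1) by Cauchy–Schwarz. The
  -- almost nonnegative Gram matrix gives ‖p‖² ≥ ∑ w² - r.
  · rw [convexHull_eq_union] at hpm
    simp only [Set.mem_iUnion] at hpm
    obtain ⟨t, htU, hind, hpt⟩ := hpm
    obtain ⟨w, hw0, hw1, hwp⟩ := Finset.mem_convexHull'.1 hpt
    have hcard : (t.card : ℝ) ≤ d + 1 := by
      have h := hind.card_le_finrank_succ
      have h' := Submodule.finrank_le (vectorSpan ℝ (Set.range (Subtype.val : t → Space d)))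
      simp only [finrank_euclideanSpace, Fintype.card_fin] at h'
      rw [Fintype.card_coe] at h
      exact_mod_cast h.trans (by gcongr)
    have hpy : ∀ y ∈ t, w y - r ≤ ⟪p, y⟫ := by
      intro y hy
      have e1 : ⟪p, y⟫ = ∑ z ∈ t, w z * ⟪z, y⟫ := by
        rw [← hwp, sum_inner]
        exact Finset.sum_congr rfl fun z _ => real_inner_smul_left _ _ _
      have e2 : ∑ z ∈ t, w z * ((if z = y then 1 else 0) - r) = w y - r := by
        simp_rw [mul_sub, Finset.sum_sub_distrib, ← Finset.sum_mul, hw1]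
        simp [hy]
      rw [e1, ← e2]
      refine Finset.sum_le_sum fun z hz => mul_le_mul_of_nonneg_left ?_ (hw0 z hz)
      split_ifs with h
      · rw [h, real_inner_self_eq_norm_sq, h1 y (htU hy)]
        linarith
      · linarith [hp z (htU hz) y (htU hy)]
    have hsq : ∑ y ∈ t, w y ^ 2 - r ≤ ‖p‖ ^ 2 := by
      have e1 : ‖p‖ ^ 2 = ∑ y ∈ t, w y * ⟪p, y⟫ := by
        rw [← real_inner_self_eq_norm_sq]
        conv_lhs => rw [← hwp, inner_sum, hwp]
        exact Finset.sum_congr rfl fun z _ => real_inner_smul_right _ _ _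
      have e2 : ∑ y ∈ t, w y * (w y - r) = ∑ y ∈ t, w y ^ 2 - r := by
        simp_rw [mul_sub, Finset.sum_sub_distrib, ← Finset.sum_mul, hw1, one_mul, sq]
      rw [e1, ← e2]
      exact Finset.sum_le_sum fun y hy => mul_le_mul_of_nonneg_left (hpy y hy) (hw0 y hy)
    have hcs := sq_sum_le_card_mul_sum_sq (s := t) (f := w)
    rw [hw1] at hcs
    have hs0 : 0 ≤ ∑ y ∈ t, w y ^ 2 := Finset.sum_nonneg fun _ _ => sq_nonneg _
    have h3 : 1 / ((d : ℝ) + 1) ≤ ∑ y ∈ t, w y ^ 2 := by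
      rw [div_le_iff₀ (by positivity)]
      nlinarith
    have h4 : 1 / ((d : ℝ) + 1) = 1 / (2 * ((d : ℝ) + 1)) + 1 / (2 * ((d : ℝ) + 1)) := by
      field_simp
      norm_num
    linarith

/-- The convex cone dual to `U`. -/
def dualCone {d : ℕ} (U : Finset (Space d)) : Set (Space d) :=
  {k | ∀ u ∈ U, 0 ≤ ⟪k, u⟫}

theorem isClosed_dualCone {d : ℕ} (U : Finset (Space d)) : IsClosed (dualCone U) := by
  have : dualCone U = ⋂ u ∈ U, {k : Space d | 0 ≤ ⟪k, u⟫} := by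
    ext k
    simp [dualCone]
  rw [this]
  exact isClosed_biInter fun u _ => isClosed_le continuous_const (by fun_prop)

theorem add_mem_dualCone {d : ℕ} {U : Finset (Space d)} {a b : Space d} (ha : a ∈ dualCone U)
    (hb : b ∈ dualCone U) : a + b ∈ dualCone U := fun u hu => by
  rw [inner_add_left]
  exact add_nonneg (ha u hu) (hb u hu)

theorem smul_mem_dualCone {d : ℕ} {U : Finset (Space d)} {a : Space d} (ha : a ∈ dualCone U)
    {c : ℝ} (hc : 0 ≤ c) : c • a ∈ dualCone U := fun u hu => by
  rw [real_inner_smul_left]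
  exact mul_nonneg hc (ha u hu)

theorem convex_dualCone {d : ℕ} (U : Finset (Space d)) : Convex ℝ (dualCone U) :=
  fun _ ha _ hb _ _ hs ht _ => add_mem_dualCone (smul_mem_dualCone ha hs) (smul_mem_dualCone hb ht)

/-- Moreau decomposition, up to a correction by `p`: each vector of the unit ball is a difference of
two vectors of the dual cone. -/
theorem exists_sub_eq_dualCone {d : ℕ} {U : Finset (Space d)} {r : ℝ} (hr0 : 0 ≤ r)
    (hp : ∀ u ∈ U, ∀ w ∈ U, -r ≤ ⟪u, w⟫) {p : Space d} (hp1 : ‖p‖ ≤ 1) (hp0 : 0 < ‖p‖)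
    (hrp : r ≤ ‖p‖ ^ 4) (hpU : ∀ u ∈ U, ‖p‖ ^ 2 ≤ ⟪p, u⟫) {x : Space d} (hx : ‖x‖ ≤ 1) :
    ∃ a ∈ dualCone U, ∃ b ∈ dualCone U, x = a - b ∧ ‖a‖ ≤ 2 ∧ ‖b‖ ≤ 2 := by
  obtain ⟨a, ha, hvar⟩ := exists_inner_sub_le_zero (x := x)
    ⟨(0 : Space d), fun u _ => by simp⟩ (isClosed_dualCone U).isComplete (convex_dualCone U)
  have h0 : ⟪x - a, a⟫ = 0 := by
    have h1 := hvar 0 (fun u _ => by simp)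
    have h2 := hvar ((2 : ℝ) • a) (smul_mem_dualCone ha (by norm_num))
    rw [two_smul, add_sub_cancel_right] at h2
    rw [zero_sub, inner_neg_right] at h1
    linarith
  have hbK : ∀ k ∈ dualCone U, 0 ≤ ⟪a - x, k⟫ := by
    intro k hk
    have h1 := hvar k hk
    rw [inner_sub_right, h0, ← neg_sub a x, inner_neg_left] at h1
    linarith
  have hpyth : ‖x‖ ^ 2 = ‖a - x‖ ^ 2 + ‖a‖ ^ 2 := by
    have : x = (x - a) + a := by abel
    conv_lhs => rw [this, norm_add_sq_real, h0]
    rw [norm_sub_rev]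
    ring
  have hb1 : ‖a - x‖ ≤ 1 := by nlinarith [norm_nonneg (a - x), norm_nonneg a, norm_nonneg x]
  have ha1 : ‖a‖ ≤ 1 := by nlinarith [norm_nonneg (a - x), norm_nonneg a, norm_nonneg x]
  have hpK : p ∈ dualCone U := fun u hu => (sq_nonneg _).trans (hpU u hu)
  have hbp : a - x + p ∈ dualCone U := by
    intro u hu
    -- If r = 0, then u itself lies in the dual cone and a - x needs no correction. In general this
    -- multiple of p absorbs the error -r, and r ≤ ‖p‖⁴ makes adding one copy of p to a - x enough.
    have hk : u + (r / ‖p‖ ^ 2) • p ∈ dualCone U := by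
      intro w hw
      rw [inner_add_left, real_inner_smul_left]
      have h1 := hp u hu w hw
      have h2 : r ≤ r / ‖p‖ ^ 2 * ⟪p, w⟫ :=
        calc r = r / ‖p‖ ^ 2 * ‖p‖ ^ 2 := by field_simp
          _ ≤ _ := by
            have := hpU w hw
            gcongr
      linarith
    have h1 := hbK _ hk
    rw [inner_add_right, real_inner_smul_right] at h1
    have h2 : ⟪a - x, p⟫ ≤ 1 := (real_inner_le_norm _ _).trans
      (mul_le_one₀ hb1 (norm_nonneg _) hp1)
    have h3 : r / ‖p‖ ^ 2 ≤ ‖p‖ ^ 2 := by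
      rw [div_le_iff₀ (by positivity)]
      linarith [show ‖p‖ ^ 2 * ‖p‖ ^ 2 = ‖p‖ ^ 4 by ring]
    have h4 : r / ‖p‖ ^ 2 * ⟪a - x, p⟫ ≤ r / ‖p‖ ^ 2 * 1 := by gcongr
    rw [inner_add_left]
    linarith [hpU u hu]
  refine ⟨a + p, add_mem_dualCone ha hpK, a - x + p, hbp, by abel, ?_, ?_⟩
  · linarith [norm_add_le a p]
  · linarith [norm_add_le (a - x) p]

/-- If every vector of the unit ball is a difference of short vectors of the dual cone, then the
dual cone fills a large part of the unit ball. -/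
theorem volume_ball_mul_le {d : ℕ} {U : Finset (Space d)}
    (h : ∀ x : Space d, ‖x‖ ≤ 1 →
      ∃ a ∈ dualCone U, ∃ b ∈ dualCone U, x = a - b ∧ ‖a‖ ≤ 2 ∧ ‖b‖ ≤ 2) :
    volume (closedBall (0 : Space d) 1) * volume (dualCone U ∩ closedBall 0 1) ≤
      volume (dualCone U ∩ closedBall 0 3) ^ 2 := by
  set A : Set (Space d) := dualCone U ∩ closedBall 0 3 with hA
  have hAm : MeasurableSet A := ((isClosed_dualCone U).inter isClosed_closedBall).measurableSet
  let g : Space d → ℝ≥0∞ := A.indicator 1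
  have hg : Measurable g := measurable_one.indicator hAm
  have hgi : ∫⁻ x, g x = volume A := lintegral_indicator_one hAm
  calc volume (closedBall (0 : Space d) 1) * volume (dualCone U ∩ closedBall 0 1)
      = ∫⁻ x in closedBall (0 : Space d) 1, volume (dualCone U ∩ closedBall 0 1) := by
        rw [setLIntegral_const, mul_comm]
    -- For x = a - b, the translate by a of the cone's part in the unit ball lies in both A and x +
    -- A. The norms 2 + 1 explain the radius 3.
    _ ≤ ∫⁻ x in closedBall (0 : Space d) 1, ∫⁻ y, g y * g (y - x) := by
        refine setLIntegral_mono' isClosed_closedBall.measurableSet fun x hx => ?_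
        rw [mem_closedBall_zero_iff] at hx
        obtain ⟨a, ha, b, hb, rfl, ha2, hb2⟩ := h x hx
        have hsub : (fun y => -a + y) ⁻¹' (dualCone U ∩ closedBall 0 1) ⊆
            {y | g y * g (y - (a - b)) = 1} := by
          rintro y ⟨hy, hy1⟩
          rw [mem_closedBall_zero_iff] at hy1
          have m1 : y ∈ A := by
            refine ⟨by simpa using add_mem_dualCone ha hy, ?_⟩
            rw [mem_closedBall_zero_iff]
            have := norm_add_le a (-a + y)
            rw [add_neg_cancel_left] at this
            linarith
          have m2 : y - (a - b) ∈ A := by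
            have e : y - (a - b) = b + (-a + y) := by abel
            refine ⟨by rw [e]; exact add_mem_dualCone hb hy, ?_⟩
            rw [mem_closedBall_zero_iff, e]
            linarith [norm_add_le b (-a + y)]
          simp only [Set.mem_ofPred_eq, g]
          rw [Set.indicator_of_mem m1, Set.indicator_of_mem m2]
          simp
        have hms : MeasurableSet ((fun y => -a + y) ⁻¹' (dualCone U ∩ closedBall 0 1)) :=
          (measurable_const_add (-a))
            ((isClosed_dualCone U).inter isClosed_closedBall).measurableSet
        rw [← measure_preimage_add volume (-a) (dualCone U ∩ closedBall 0 1),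
          ← lintegral_indicator_one hms]
        refine lintegral_mono fun y => ?_
        by_cases hy : y ∈ (fun y => -a + y) ⁻¹' (dualCone U ∩ closedBall 0 1)
        · rw [Set.indicator_of_mem hy, hsub hy]
          simp
        · rw [Set.indicator_of_notMem hy]
          exact zero_le
    _ ≤ ∫⁻ x, ∫⁻ y, g y * g (y - x) := setLIntegral_le_lintegral _ _
    _ = ∫⁻ y, ∫⁻ x, g y * g (y - x) := by
        refine lintegral_lintegral_swap (Measurable.aemeasurable ?_)
        exact (hg.comp measurable_snd).mul (hg.comp (measurable_snd.sub measurable_fst))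
    _ = ∫⁻ y, g y * volume A := by
        refine lintegral_congr fun y => ?_
        have hgy : Measurable fun x => g (y - x) := hg.comp (measurable_const.sub measurable_id)
        rw [lintegral_const_mul _ hgy,
          lintegral_sub_left_eq_self g y, hgi]
    _ = volume A ^ 2 := by rw [lintegral_mul_const _ hg, hgi, sq]

theorem volume_dualCone_three {d : ℕ} (U : Finset (Space d)) :
    volume (dualCone U ∩ closedBall 0 3) =
      ENNReal.ofReal (3 ^ d) * volume (dualCone U ∩ closedBall 0 1) := by
  have e : dualCone U ∩ closedBall 0 3 = (3 : ℝ) • (dualCone U ∩ closedBall 0 1) := by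
    ext x
    rw [Set.mem_smul_set_iff_inv_smul_mem₀ (by norm_num)]
    simp only [Set.mem_inter_iff, mem_closedBall_zero_iff, norm_smul]
    refine and_congr ⟨fun hx => smul_mem_dualCone hx (by norm_num), fun hx => ?_⟩ ?_
    · simpa using smul_mem_dualCone hx (show (0 : ℝ) ≤ 3 by norm_num)
    · norm_num
      constructor <;> intro <;> linarith
  rw [e, Measure.addHaar_smul]
  simp

/-- The directions making a uniformly positive inner product with all members of an almost acute
family of unit vectors fill an exponentially large part of the unit ball. -/
theorem volume_setOf_inner_ge {d : ℕ} {U : Finset (Space d)} (hU : U.Nonempty) {r : ℝ}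
    (h1 : ∀ u ∈ U, ‖u‖ = 1) (hr : r ≤ 1 / (2 * ((d : ℝ) + 1)) ^ 2) (hr0 : 0 ≤ r)
    (hp : ∀ u ∈ U, ∀ w ∈ U, -r ≤ ⟪u, w⟫) :
    volume.real (closedBall (0 : Space d) 1) / 18 ^ d ≤
      volume.real {v : Space d | v ∈ closedBall 0 1 ∧ ∀ u ∈ U, 1 / (4 * ((d : ℝ) + 1)) ≤ ⟪v, u⟫} := by
  have hd : (0 : ℝ) ≤ d := Nat.cast_nonneg d
  have hr' : r ≤ 1 / (2 * ((d : ℝ) + 1)) := hr.trans (by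
    refine one_div_le_one_div_of_le (by positivity) ?_
    nlinarith)
  obtain ⟨p, hp1, hpq, hpU⟩ := exists_inner_ge_of_pairwise hU h1 hr' hr0 hp
  set q : ℝ := 1 / (2 * ((d : ℝ) + 1)) with hq
  have hq0 : 0 < q := by positivity
  have hp0 : 0 < ‖p‖ := by
    by_contra hle
    have : ‖p‖ = 0 := le_antisymm (not_lt.1 hle) (norm_nonneg _)
    rw [this] at hpq
    norm_num at hpq
    linarith
  have hrp : r ≤ ‖p‖ ^ 4 := by
    have e : (1 : ℝ) / (2 * ((d : ℝ) + 1)) ^ 2 = q ^ 2 := by rw [hq]; field_simp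
    have : q ^ 2 ≤ (‖p‖ ^ 2) ^ 2 := by gcongr
    rw [e] at hr
    linarith [show (‖p‖ ^ 2) ^ 2 = ‖p‖ ^ 4 by ring]
  have hmain := volume_ball_mul_le (U := U)
    fun x hx => exists_sub_eq_dualCone hr0 hp hp1 hp0 hrp hpU hx
  rw [volume_dualCone_three] at hmain
  set K1 : Set (Space d) := dualCone U ∩ closedBall 0 1 with hK1
  have hfin : volume K1 ≠ ∞ :=
    ((measure_mono Set.inter_subset_right).trans_lt measure_closedBall_lt_top).ne
  -- Positivity allows one factor `volume K1` to be cancelled below; the ball of radius q/2 about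
  -- p/2 lies in `K1`.
  have hpos : 0 < volume K1 := by
    refine (measure_ball_pos volume ((2⁻¹ : ℝ) • p) (show 0 < q / 2 by positivity)).trans_le
      (measure_mono fun y hy => ?_)
    rw [mem_ball, dist_eq_norm] at hy
    have hqh : q ≤ 1 := hpq.trans (pow_le_one₀ (norm_nonneg _) hp1)
    have e : y = (2⁻¹ : ℝ) • p + (y - (2⁻¹ : ℝ) • p) := by abel
    refine ⟨fun u hu => ?_, ?_⟩
    · have h2 := abs_le.1 (abs_real_inner_le_norm (y - (2⁻¹ : ℝ) • p) u)
      rw [h1 u hu, mul_one] at h2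
      rw [e, inner_add_left, real_inner_smul_left]
      linarith [hpU u hu]
    · rw [mem_closedBall_zero_iff, e]
      refine (norm_add_le _ _).trans ?_
      rw [norm_smul]
      norm_num
      linarith
  have hreal : volume.real (closedBall (0 : Space d) 1) ≤ 9 ^ d * volume.real K1 := by
    have h := ENNReal.toReal_mono (by finiteness) hmain
    rw [ENNReal.toReal_mul, ENNReal.toReal_pow, ENNReal.toReal_mul,
      ENNReal.toReal_ofReal (by positivity)] at h
    change volume.real _ * volume.real K1 ≤ (3 ^ d * volume.real K1) ^ 2 at h
    have hk : 0 < volume.real K1 := ENNReal.toReal_pos hpos.ne' hfin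
    have e : (3 ^ d * volume.real K1) ^ 2 = 9 ^ d * volume.real K1 * volume.real K1 := by
      rw [mul_pow, ← pow_mul, mul_comm d 2, pow_mul]
      norm_num
      ring
    rw [e] at h
    exact le_of_mul_le_mul_right h hk
  -- Shifting by p/2 raises the inner products from nonnegative to at least q/2. Halving the cone
  -- keeps the result in the unit ball and turns 9^d into 18^d.
  have hsub : (fun y => (-(2⁻¹ : ℝ) • p) + y) ⁻¹' ((2⁻¹ : ℝ) • K1) ⊆
      {v : Space d | v ∈ closedBall 0 1 ∧ ∀ u ∈ U, 1 / (4 * ((d : ℝ) + 1)) ≤ ⟪v, u⟫} := by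
    rintro y ⟨k, ⟨hkU, hkb⟩, hky⟩
    have e : y = (2⁻¹ : ℝ) • p + (2⁻¹ : ℝ) • k := by
      simp only at hky
      rw [hky]
      simp
    rw [mem_closedBall_zero_iff] at hkb
    refine ⟨?_, fun u hu => ?_⟩
    · rw [mem_closedBall_zero_iff, e]
      refine (norm_add_le _ _).trans ?_
      rw [norm_smul, norm_smul]
      norm_num
      linarith
    · rw [e, inner_add_left, real_inner_smul_left, real_inner_smul_left]
      have h2 : 1 / (4 * ((d : ℝ) + 1)) = 2⁻¹ * q := by rw [hq]; field_simp; norm_num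
      linarith [hpU u hu, hkU u hu]
  have hV : volume.real ((fun y => (-(2⁻¹ : ℝ) • p) + y) ⁻¹' ((2⁻¹ : ℝ) • K1)) =
      (2⁻¹) ^ d * volume.real K1 := by
    rw [Measure.real, measure_preimage_add, Measure.addHaar_smul, ENNReal.toReal_mul,
      ENNReal.toReal_ofReal (abs_nonneg _), Measure.real]
    simp
  calc volume.real (closedBall (0 : Space d) 1) / 18 ^ d
      ≤ 9 ^ d * volume.real K1 / 18 ^ d := by gcongr
    _ = (2⁻¹) ^ d * volume.real K1 := by
        rw [show (18 : ℝ) = 9 * 2 by norm_num, mul_pow, inv_pow]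
        field_simp
    _ ≤ _ := by
        rw [← hV]
        refine measureReal_mono hsub ?_
        exact ((measure_mono fun v hv => hv.1).trans_lt
          (measure_closedBall_lt_top (x := (0 : Space d)) (r := 1))).ne

/-! ### Mean support functions of tails -/

/-- The support function, in direction `-v` and relative to `y k`, of the points `y a, …, y k`. -/
noncomputable def tailSupport {d : ℕ} (y : ℕ → Space d) (k a : ℕ) (v : Space d) : ℝ :=
  -- Inserting k keeps the index set nonempty when a > k; it changes nothing when a ≤ k.
  (insert k (Finset.Icc a k)).sup' (Finset.insert_nonempty _ _) fun c => -⟪v, y c - y k⟫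

theorem continuous_tailSupport {d : ℕ} (y : ℕ → Space d) (k a : ℕ) :
    Continuous (tailSupport y k a) :=
  Continuous.finset_sup'_apply (f := fun c v => -⟪v, y c - y k⟫) (Finset.insert_nonempty _ _)
    fun _ _ => by fun_prop

theorem le_tailSupport {d : ℕ} (y : ℕ → Space d) {k a c : ℕ} (hac : a ≤ c) (hck : c ≤ k)
    (v : Space d) : -⟪v, y c - y k⟫ ≤ tailSupport y k a v :=
  Finset.le_sup' (fun c => -⟪v, y c - y k⟫)
    (Finset.mem_insert_of_mem (Finset.mem_Icc.2 ⟨hac, hck⟩))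

theorem tailSupport_le {d : ℕ} {y : ℕ → Space d} {k a : ℕ} (hak : a ≤ k) {v : Space d} {b : ℝ}
    (h : ∀ c, a ≤ c → c ≤ k → -⟪v, y c - y k⟫ ≤ b) : tailSupport y k a v ≤ b := by
  refine Finset.sup'_le _ _ fun c hc => ?_
  rw [Finset.insert_eq_of_mem (Finset.mem_Icc.2 ⟨hak, le_rfl⟩), Finset.mem_Icc] at hc
  exact h c hc.1 hc.2

theorem integrableOn_tailSupport {d : ℕ} (y : ℕ → Space d) (k a : ℕ) :
    IntegrableOn (tailSupport y k a) (closedBall (0 : Space d) 1) :=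
  (continuous_tailSupport y k a).continuousOn.integrableOn_compact (isCompact_closedBall _ _)

/-- The mean of the support function of the tail drops at least in proportion to the step. -/
theorem integral_tailSupport_succ_le {d : ℕ} {y : ℕ → Space d} {a k : ℕ} (hak : a < k) {r : ℝ}
    (hr : r ≤ 1 / (2 * ((d : ℝ) + 1)) ^ 2) (hr0 : 0 ≤ r)
    (hC : ∀ b c, a < b → b ≤ c → c ≤ k →
      ‖y b - y a‖ ^ 2 / 2 - r * ‖y b - y a‖ * ‖y c - y a‖ ≤ ⟪y b - y a, y c - y a⟫) :
    volume.real (closedBall (0 : Space d) 1) * ‖y (a + 1) - y a‖ / (16 * ((d : ℝ) + 1) * 18 ^ d) ≤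
      (∫ v in closedBall (0 : Space d) 1, tailSupport y k a v) -
        ∫ v in closedBall (0 : Space d) 1, tailSupport y k (a + 1) v := by
  classical
  have hmono : ∀ v, tailSupport y k (a + 1) v ≤ tailSupport y k a v := fun v =>
    tailSupport_le hak fun c hc hck => le_tailSupport y (by omega) hck v
  have hd : (0 : ℝ) ≤ d := Nat.cast_nonneg d
  rcases eq_or_lt_of_le (norm_nonneg (y (a + 1) - y a)) with h0 | hpos
  · rw [← h0, mul_zero, zero_div, sub_nonneg]
    exact setIntegral_mono (integrableOn_tailSupport _ _ _) (integrableOn_tailSupport _ _ _) hmono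
  have hr1 : r ≤ 1 := hr.trans (by
    rw [div_le_one (by positivity)]
    nlinarith)
  -- The case b = a+1 of `hC`: no later vertex comes closer to y a than a quarter of the step. This
  -- turns the angular bound into an absolute drop `e`.
  have hlow : ∀ c, a < c → c ≤ k → ‖y (a + 1) - y a‖ / 4 ≤ ‖y c - y a‖ := by
    intro c hc hck
    have h1 := hC (a + 1) c (by omega) hc hck
    have h2 := real_inner_le_norm (y (a + 1) - y a) (y c - y a)
    have h3 : ‖y (a + 1) - y a‖ / 2 ≤ (1 + r) * ‖y c - y a‖ := by
      by_contra hlt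
      push Not at hlt
      nlinarith
    nlinarith [norm_nonneg (y c - y a)]
  have hne : ∀ c, a < c → c ≤ k → 0 < ‖y c - y a‖ := fun c hc hck =>
    lt_of_lt_of_le (by positivity) (hlow c hc hck)
  let U : Finset (Space d) := (Finset.Ioc a k).image fun c => ‖y c - y a‖⁻¹ • (y c - y a)
  have hUne : U.Nonempty := (Finset.nonempty_Ioc.2 hak).image _
  have hU1 : ∀ u ∈ U, ‖u‖ = 1 := by
    intro u hu
    obtain ⟨c, hc, rfl⟩ := Finset.mem_image.1 hu
    rw [Finset.mem_Ioc] at hc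
    rw [norm_smul, norm_inv, norm_norm, inv_mul_cancel₀ (hne c hc.1 hc.2).ne']
  have hpair : ∀ b c, a < b → b ≤ c → c ≤ k →
      -r ≤ ⟪‖y b - y a‖⁻¹ • (y b - y a), ‖y c - y a‖⁻¹ • (y c - y a)⟫ := by
    intro b c hb hbc hck
    have hb0 := hne b hb (hbc.trans hck)
    have hc0 := hne c (hb.trans_le hbc) hck
    rw [real_inner_smul_left, real_inner_smul_right, ← mul_assoc, ← mul_inv, ← div_eq_inv_mul,
      le_div_iff₀ (by positivity)]
    nlinarith [hC b c hb hbc hck, sq_nonneg ‖y b - y a‖]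
  have hUp : ∀ u ∈ U, ∀ w ∈ U, -r ≤ ⟪u, w⟫ := by
    intro u hu w hw
    obtain ⟨b, hb, rfl⟩ := Finset.mem_image.1 hu
    obtain ⟨c, hc, rfl⟩ := Finset.mem_image.1 hw
    rw [Finset.mem_Ioc] at hb hc
    rcases le_total b c with h | h
    · exact hpair b c hb.1 h hc.2
    · rw [real_inner_comm]
      exact hpair c b hc.1 h hb.2
  have hvol := volume_setOf_inner_ge hUne hU1 hr hr0 hUp
  set V : Set (Space d) :=
    {v : Space d | v ∈ closedBall 0 1 ∧ ∀ u ∈ U, 1 / (4 * ((d : ℝ) + 1)) ≤ ⟪v, u⟫} with hV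
  have hVm : MeasurableSet V := by
    have e : V = closedBall 0 1 ∩ ⋂ u ∈ U, {v : Space d | 1 / (4 * ((d : ℝ) + 1)) ≤ ⟪v, u⟫} := by
      ext v
      simp [hV]
    rw [e]
    exact (isClosed_closedBall.inter (isClosed_biInter fun u _ =>
      isClosed_le continuous_const (by fun_prop))).measurableSet
  have hVB : V ⊆ closedBall 0 1 := fun v hv => hv.1
  set e : ℝ := 1 / (4 * ((d : ℝ) + 1)) * (‖y (a + 1) - y a‖ / 4) with he
  -- For v in `V`, every later vertex lies at least `e` further along v than y a, so deleting y a
  -- lowers the maximum by at least `e`.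
  have hpt : ∀ v, V.indicator (fun _ => e) v + tailSupport y k (a + 1) v ≤ tailSupport y k a v := by
    intro v
    by_cases hv : v ∈ V
    · rw [Set.indicator_of_mem hv, ← le_sub_iff_add_le']
      refine tailSupport_le hak fun c hc hck => ?_
      have h1 := hv.2 _ (Finset.mem_image_of_mem _ (Finset.mem_Ioc.2 ⟨hc, hck⟩))
      have hc0 := hne c hc hck
      rw [real_inner_smul_right, ← div_eq_inv_mul, le_div_iff₀ hc0] at h1
      have h2 : e ≤ 1 / (4 * ((d : ℝ) + 1)) * ‖y c - y a‖ := by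
        have := hlow c hc hck
        rw [he]
        gcongr
      have h3 := le_tailSupport y (le_refl a) hak.le v
      have e1 : y c - y k = (y c - y a) + (y a - y k) := by abel
      rw [e1, inner_add_right]
      linarith
    · rw [Set.indicator_of_notMem hv, zero_add]
      exact hmono v
  have hint : IntegrableOn (V.indicator fun _ => e) (closedBall (0 : Space d) 1) :=
    (integrableOn_const (measure_closedBall_lt_top.ne)).indicator hVm
  have hI := setIntegral_mono (hint.add (integrableOn_tailSupport y k (a + 1)))
    (integrableOn_tailSupport y k a) hpt
  have hsplit := integral_add hint (integrableOn_tailSupport y k (a + 1))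
  simp only [Pi.add_apply] at hI hsplit
  rw [hsplit, setIntegral_indicator hVm, Set.inter_eq_right.2 hVB, setIntegral_const,
    smul_eq_mul] at hI
  have h4 : volume.real (closedBall (0 : Space d) 1) / 18 ^ d * e ≤ volume.real V * e :=
    mul_le_mul_of_nonneg_right hvol (by positivity)
  have h5 : volume.real (closedBall (0 : Space d) 1) / 18 ^ d * e =
      volume.real (closedBall (0 : Space d) 1) * ‖y (a + 1) - y a‖ /
        (16 * ((d : ℝ) + 1) * 18 ^ d) := by
    rw [he]
    field_simp
    norm_num
  linarith

/-- A polygonal line each of whose points sees the later points under almost acute angles has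
length at most a constant times the radius of its set of vertices. -/
theorem sum_norm_le_of_inner {d : ℕ} {y : ℕ → Space d} {i k : ℕ} (hik : i ≤ k) {r R : ℝ}
    (hr : r ≤ 1 / (2 * ((d : ℝ) + 1)) ^ 2) (hr0 : 0 ≤ r)
    (hC : ∀ a b c, i ≤ a → a < b → b ≤ c → c ≤ k →
      ‖y b - y a‖ ^ 2 / 2 - r * ‖y b - y a‖ * ‖y c - y a‖ ≤ ⟪y b - y a, y c - y a⟫)
    (hR : ∀ j, i ≤ j → j ≤ k → ‖y j - y k‖ ≤ R) :
    ∑ j ∈ Finset.Ico i k, ‖y (j + 1) - y j‖ ≤ 16 * ((d : ℝ) + 1) * 18 ^ d * R := by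
  set B : Set (Space d) := closedBall 0 1 with hB
  let I : ℕ → ℝ := fun a => ∫ v in B, tailSupport y k a v
  have hω : 0 < volume.real B :=
    ENNReal.toReal_pos (measure_closedBall_pos volume (0 : Space d) one_pos).ne'
      measure_closedBall_lt_top.ne
  have hstep : ∑ j ∈ Finset.Ico i k,
      volume.real B * ‖y (j + 1) - y j‖ / (16 * ((d : ℝ) + 1) * 18 ^ d) ≤ I i - I k := by
    have htel : ∑ j ∈ Finset.Ico i k, (I j - I (j + 1)) = I i - I k := by
      have := Finset.sum_Ico_sub I hik
      simp_rw [← neg_sub (I (_ + 1)), Finset.sum_neg_distrib, this, neg_sub]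
    rw [← htel]
    refine Finset.sum_le_sum fun j hj => ?_
    rw [Finset.mem_Ico] at hj
    exact integral_tailSupport_succ_le hj.2 hr hr0 fun b c => hC j b c hj.1
  have hIk : 0 ≤ I k := by
    refine integral_nonneg fun v => ?_
    have := le_tailSupport y (le_refl k) le_rfl v
    rwa [sub_self, inner_zero_right, neg_zero] at this
  have hR0 : 0 ≤ R := (norm_nonneg _).trans (hR i le_rfl hik)
  have hIi : I i ≤ volume.real B * R := by
    have h := setIntegral_mono_on (integrableOn_tailSupport y k i)
      (integrableOn_const (C := R) (measure_closedBall_lt_top (x := (0 : Space d)) (r := 1)).ne)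
      isClosed_closedBall.measurableSet (fun v hv => tailSupport_le hik fun c hc hck => by
        rw [mem_closedBall_zero_iff] at hv
        have h1 := (abs_le.1 (abs_real_inner_le_norm v (y c - y k))).1
        have h2 : ‖v‖ * ‖y c - y k‖ ≤ 1 * R :=
          mul_le_mul hv (hR c hc hck) (norm_nonneg _) zero_le_one
        linarith)
    rwa [setIntegral_const, smul_eq_mul] at h
  rw [← Finset.sum_div, ← Finset.mul_sum] at hstep
  have h := hstep.trans (show I i - I k ≤ volume.real B * R by linarith)
  rw [div_le_iff₀ (by positivity), mul_assoc] at h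
  have := le_of_mul_le_mul_left h hω
  linarith

/-! ### Lengths of almost self-contracted polygonal lines -/

/-- The length of the polygonal line `y a, …, y b`. -/
noncomputable def pathLength {d : ℕ} (y : ℕ → Space d) (a b : ℕ) : ℝ :=
  ∑ j ∈ Finset.Ico a b, ‖y (j + 1) - y j‖

section pathLength

variable {d : ℕ} (y : ℕ → Space d)

theorem pathLength_self (a : ℕ) : pathLength y a a = 0 := by simp [pathLength]

theorem pathLength_nonneg (a b : ℕ) : 0 ≤ pathLength y a b :=
  Finset.sum_nonneg fun _ _ => norm_nonneg _

theorem pathLength_succ {a b : ℕ} (h : a ≤ b) :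
    pathLength y a (b + 1) = pathLength y a b + ‖y (b + 1) - y b‖ :=
  Finset.sum_Ico_succ_top h _

theorem pathLength_add {a b c : ℕ} (hab : a ≤ b) (hbc : b ≤ c) :
    pathLength y a b + pathLength y b c = pathLength y a c :=
  Finset.sum_Ico_consecutive _ hab hbc

theorem pathLength_anti_left {a b c : ℕ} (hab : a ≤ b) (hbc : b ≤ c) :
    pathLength y b c ≤ pathLength y a c := by
  linarith [pathLength_add y hab hbc, pathLength_nonneg y a b]

end pathLength

/-- The constant in the length bound for almost self-contracted polygonal lines. -/
noncomputable def lengthConst (d : ℕ) : ℝ := 64 * 36 ^ d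

/-- The error allowed in the length bound for almost self-contracted polygonal lines. -/
noncomputable def tolerance (d : ℕ) : ℝ := 1 / (409600 * 5184 ^ d)

theorem tolerance_pos (d : ℕ) : 0 < tolerance d := by
  unfold tolerance
  positivity

theorem tolerance_le_one (d : ℕ) : tolerance d ≤ 1 := by
  unfold tolerance
  rw [div_le_one (by positivity)]
  have : (1 : ℝ) ≤ 5184 ^ d := one_le_pow₀ (by norm_num)
  linarith

theorem one_le_lengthConst (d : ℕ) : 1 ≤ lengthConst d := by
  unfold lengthConst
  have : (1 : ℝ) ≤ 36 ^ d := one_le_pow₀ (by norm_num)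
  linarith

theorem natCast_add_one_le_two_pow (d : ℕ) : (d : ℝ) + 1 ≤ 2 ^ d := by
  exact_mod_cast Nat.lt_two_pow_self

/-- The 32 is the 16 of `sum_norm_le_of_inner` doubled, because the vertices lie within twice the
end-point distance of the last one. -/
theorem le_lengthConst (d : ℕ) : 32 * ((d : ℝ) + 1) * 18 ^ d ≤ lengthConst d := by
  have h := natCast_add_one_le_two_pow d
  have e : (36 : ℝ) ^ d = 2 ^ d * 18 ^ d := by rw [← mul_pow]; norm_num
  have : ((d : ℝ) + 1) * 18 ^ d ≤ 36 ^ d := by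
    rw [e]
    gcongr
  unfold lengthConst
  nlinarith [show (0 : ℝ) < 36 ^ d by positivity]

/-- The tolerance is chosen for this identity: 25εΛ² is the angular error arising in
`pathLength_le`, and since d + 1 ≤ 2^d it is small enough for the dual cone estimate. -/
theorem tolerance_mul_lengthConst_sq (d : ℕ) :
    25 * tolerance d * lengthConst d ^ 2 = 1 / (2 * 2 ^ d) ^ 2 := by
  have e : (5184 : ℝ) ^ d = (36 ^ d) ^ 2 * (2 ^ d) ^ 2 := by
    rw [← mul_pow, ← mul_pow, ← pow_mul, mul_comm d 2, pow_mul]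
    norm_num
  unfold tolerance lengthConst
  rw [e]
  field_simp
  norm_num

theorem tolerance_mul_lengthConst_sq_le (d : ℕ) :
    25 * tolerance d * lengthConst d ^ 2 ≤ 1 / (2 * ((d : ℝ) + 1)) ^ 2 := by
  rw [tolerance_mul_lengthConst_sq]
  have := natCast_add_one_le_two_pow d
  gcongr

/-- An almost self-contracted polygonal line is not longer than a constant times the distance of its
end points. -/
theorem pathLength_le {d : ℕ} (y : ℕ → Space d) {i k : ℕ} (hik : i ≤ k)
    (h : ∀ m n, i ≤ m → m < n → n ≤ k →
      ‖y (m + 1) - y n‖ ^ 2 ≤ ‖y m - y n‖ ^ 2 +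
        2 * tolerance d * pathLength y (m + 1) n * ‖y (m + 1) - y m‖) :
    pathLength y i k ≤ lengthConst d * ‖y i - y k‖ := by
  obtain ⟨N, hN⟩ : ∃ N, k - i = N := ⟨_, rfl⟩
  induction N using Nat.strong_induction_on generalizing i k with
  | _ N ih =>
    have hε0 := tolerance_pos d
    have hΛ1 := one_le_lengthConst d
    set ε := tolerance d
    set Λ := lengthConst d with hΛ
    set r := 25 * ε * Λ ^ 2 with hr
    have hr4 : r ≤ 1 / (2 * ((d : ℝ) + 1)) ^ 2 := tolerance_mul_lengthConst_sq_le d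
    have hr4' : r ≤ 1 / 4 := hr4.trans (by
      refine one_div_le_one_div_of_le (by norm_num) ?_
      nlinarith [show (0 : ℝ) ≤ d from Nat.cast_nonneg d])
    have hr0 : 0 ≤ r := by positivity
    have hεΛ : 2 * ε * Λ ≤ 1 / 8 := by nlinarith [mul_pos hε0 (show 0 < Λ by linarith)]
    rcases hik.eq_or_lt with rfl | hlt
    · simp [pathLength_self]
    -- Bootstrap: a worse constant 5Λ suffices to control the errors. Proper subintervals have
    -- constant Λ by induction; on the whole interval, split off the first step and use that y (a+1)
    -- is at most twice as far from y c as y a is.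
    have hweak : ∀ a c, i ≤ a → a ≤ c → c ≤ k → pathLength y a c ≤ 5 * Λ * ‖y a - y c‖ := by
      intro a c hia hac hck
      by_cases hN' : c - a < N
      · have h1 := ih _ hN' hac (fun m n hm hmn hn => h m n (hia.trans hm) hmn (hn.trans hck)) rfl
        nlinarith [norm_nonneg (y a - y c)]
      · obtain rfl : a = i := by omega
        obtain rfl : c = k := by omega
        have h1 := ih (c - (a + 1)) (by omega) (show a + 1 ≤ c from hlt)
          (fun m n hm => h m n (by omega)) rfl
        have h2 := h a c le_rfl hlt le_rfl
        have h3 : ‖y (a + 1) - y a‖ ≤ ‖y (a + 1) - y c‖ + ‖y a - y c‖ := by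
          rw [norm_sub_rev (y a)]
          exact norm_sub_le_norm_sub_add_norm_sub _ _ _
        have h4 : pathLength y a c = ‖y (a + 1) - y a‖ + pathLength y (a + 1) c := by
          rw [← pathLength_add y (Nat.le_succ a) hlt, pathLength_succ y le_rfl, pathLength_self,
            zero_add]
        set ρ := ‖y (a + 1) - y c‖
        set R := ‖y a - y c‖
        have hρ : 0 ≤ ρ := norm_nonneg _
        have hR : 0 ≤ R := norm_nonneg _
        have h5 : ρ ^ 2 ≤ R ^ 2 + 1 / 8 * ρ * (ρ + R) := by
          refine h2.trans ?_
          have : 2 * ε * pathLength y (a + 1) c * ‖y (a + 1) - y a‖ ≤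
              2 * ε * (Λ * ρ) * (ρ + R) := by gcongr
          have h7 : 2 * ε * (Λ * ρ) * (ρ + R) ≤ 1 / 8 * ρ * (ρ + R) := by
            rw [← mul_assoc (2 * ε)]
            gcongr
          linarith
        have h6 : ρ ≤ 2 * R := by
          by_contra hc
          push Not at hc
          nlinarith
        rw [h4]
        nlinarith
    -- Summing the errors from a to b leaves a product of two path lengths. Replacing each by 5Λ
    -- times a distance produces the factor 25Λ² in `r`.
    have hdist : ∀ a b c, i ≤ a → a ≤ b → b ≤ c → c ≤ k →
        ‖y b - y c‖ ^ 2 ≤ ‖y a - y c‖ ^ 2 + 2 * r * ‖y a - y c‖ * ‖y a - y b‖ := by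
      intro a b c hia hab hbc hck
      have h1 : ‖y b - y c‖ ^ 2 ≤
          ‖y a - y c‖ ^ 2 + 2 * ε * pathLength y a c * pathLength y a b := by
        induction b, hab using Nat.le_induction with
        | base => simp [pathLength_self]
        | succ b hab ihb =>
          have h2 := ihb (by omega)
          have h3 := h b c (by omega) (by omega) hck
          have h4 : 2 * ε * pathLength y (b + 1) c * ‖y (b + 1) - y b‖ ≤
              2 * ε * pathLength y a c * ‖y (b + 1) - y b‖ := by
            have := pathLength_anti_left y (show a ≤ b + 1 by omega) hbc
            gcongr
          rw [pathLength_succ y hab]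
          linarith
      have h2 : 2 * ε * pathLength y a c * pathLength y a b ≤
          2 * ε * (5 * Λ * ‖y a - y c‖) * (5 * Λ * ‖y a - y b‖) := by
        have := hweak a c hia (hab.trans hbc) hck
        have := hweak a b hia hab (hbc.trans hck)
        have := pathLength_nonneg y a b
        gcongr
      refine h1.trans ((add_le_add_right h2 _).trans_eq ?_)
      rw [hr]
      ring
    have hrad : ∀ j, i ≤ j → j ≤ k → ‖y j - y k‖ ≤ 2 * ‖y i - y k‖ := by
      intro j hij hjk
      have h1 := hdist i j k le_rfl hij hjk le_rfl
      have h2 : ‖y i - y j‖ ≤ ‖y i - y k‖ + ‖y j - y k‖ := by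
        rw [norm_sub_rev (y j)]
        exact norm_sub_le_norm_sub_add_norm_sub _ _ _
      set ρ := ‖y j - y k‖
      set R := ‖y i - y k‖
      have hρ : 0 ≤ ρ := norm_nonneg _
      have hR : 0 ≤ R := norm_nonneg _
      have h3 : 2 * r * R * ‖y i - y j‖ ≤ 2 * (1 / 4) * R * (R + ρ) := by gcongr
      by_contra hc
      push Not at hc
      nlinarith
    -- Expanding the square in `hdist` gives the almost acute angles; the resulting length bound
    -- restores the constant Λ.
    have hlen := sum_norm_le_of_inner hik hr4 hr0 (fun a b c hia hab hbc hck => by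
      have h1 := hdist a b c hia hab.le hbc hck
      have h2 := norm_sub_sq_real (y b - y a) (y c - y a)
      rw [sub_sub_sub_cancel_right] at h2
      rw [norm_sub_rev (y a) (y c), norm_sub_rev (y a) (y b)] at h1
      linarith) hrad
    refine hlen.trans ?_
    have := le_lengthConst d
    calc 16 * ((d : ℝ) + 1) * 18 ^ d * (2 * ‖y i - y k‖)
        = 32 * ((d : ℝ) + 1) * 18 ^ d * ‖y i - y k‖ := by ring
      _ ≤ Λ * ‖y i - y k‖ := by gcongr

/-- A self-contracted polygonal line is not longer than a constant times the distance of its end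
points. -/
theorem pathLength_le_of_selfContracted {d : ℕ} (y : ℕ → Space d) {i k : ℕ} (hik : i ≤ k)
    (h : ∀ m n, i ≤ m → m < n → n ≤ k → ‖y (m + 1) - y n‖ ≤ ‖y m - y n‖) :
    pathLength y i k ≤ lengthConst d * ‖y i - y k‖ :=
  pathLength_le y hik fun m n hm hmn hn => by
    have h1 : ‖y (m + 1) - y n‖ ^ 2 ≤ ‖y m - y n‖ ^ 2 := by
      have := h m n hm hmn hn
      gcongr
    have h2 : 0 ≤ 2 * tolerance d * pathLength y (m + 1) n * ‖y (m + 1) - y m‖ :=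
      mul_nonneg (mul_nonneg (by linarith [tolerance_pos d]) (pathLength_nonneg _ _ _))
        (norm_nonneg _)
    linarith

/-! ### Projections and minimizer sets -/

section proj

variable {d : ℕ} {K : Set (Space d)}

theorem inner_sub_proj_le_zero (hne : K.Nonempty) (hcl : IsClosed K) (hcv : Convex ℝ K)
    (x : Space d) {w : Space d} (hw : w ∈ K) : ⟪x - proj K x, w - proj K x⟫ ≤ 0 := by
  obtain ⟨a, ha, h⟩ := exists_inner_sub_le_zero hne hcl.isComplete hcv x
  have e : a = proj K x := by
    refine eq_proj hcl hcv x ha fun y hy => ?_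
    have h1 := h y hy
    have h2 := norm_sub_sq_real (x - a) (y - a)
    rw [sub_sub_sub_cancel_right] at h2
    rw [dist_eq_norm, dist_eq_norm]
    refine le_of_sq_le_sq ?_ (norm_nonneg _)
    nlinarith [sq_nonneg ‖y - a‖]
  exact e ▸ h w hw

/-- Projecting onto a set near `z` almost decreases the distance to `z`. -/
theorem norm_proj_sub_sq_le (hne : K.Nonempty) (hcl : IsClosed K) (hcv : Convex ℝ K)
    (x z : Space d) {w : Space d} (hw : w ∈ K) :
    ‖proj K x - z‖ ^ 2 ≤ ‖x - z‖ ^ 2 + 2 * ‖z - w‖ * ‖x - proj K x‖ := by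
  set p := proj K x
  have h1 : ⟪x - p, w - p⟫ ≤ 0 := inner_sub_proj_le_zero hne hcl hcv x hw
  have h2 := real_inner_le_norm (x - p) (z - w)
  have h3 := norm_sub_sq_real (x - p) (z - p)
  rw [sub_sub_sub_cancel_right] at h3
  have h4 : z - p = (w - p) + (z - w) := by abel
  rw [h4, inner_add_right, ← h4] at h3
  rw [norm_sub_rev p z]
  nlinarith [sq_nonneg ‖x - p‖]

theorem norm_proj_sub_le (hne : K.Nonempty) (hcl : IsClosed K) (hcv : Convex ℝ K)
    (x : Space d) {z : Space d} (hz : z ∈ K) : ‖proj K x - z‖ ≤ ‖x - z‖ := by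
  have h := norm_proj_sub_sq_le hne hcl hcv x z hz
  rw [sub_self, norm_zero, mul_zero, zero_mul, add_zero] at h
  exact le_of_sq_le_sq h (norm_nonneg _)

end proj

theorem minValue_eq {d : ℕ} {f : Space d → ℝ} {K : Set (Space d)} {z : Space d}
    (hz : z ∈ argminSet f K) : minValue f K = f z :=
  IsLeast.csInf_eq ⟨⟨z, hz.1, rfl⟩, by rintro _ ⟨y, hy, rfl⟩; exact hz.2 y hy⟩

namespace IsInstance

variable {d : ℕ} {X : Set (Space d)} {f : Space d → ℝ} {S : ℕ → Set (Space d)} {x₀ : Space d}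
  {T : ℕ}

theorem S_subset_S (hI : IsInstance X f S x₀ T) {s t : ℕ} (hs : 1 ≤ s) (hst : s ≤ t) (ht : t ≤ T) :
    S t ⊆ S s := by
  induction t, hst using Nat.le_induction with
  | base => exact subset_rfl
  | succ t hst ih => exact (hI.nested_S t (by omega) (by omega)).trans (ih (by omega))

theorem S_subset_X (hI : IsInstance X f S x₀ T) {t : ℕ} (h1 : 1 ≤ t) (ht : t ≤ T) : S t ⊆ X :=
  (hI.S_subset_S le_rfl h1 ht).trans hI.first_subset

theorem argminSet_nonempty (hI : IsInstance X f S x₀ T) {G : ℝ≥0} (hG : LipschitzOnWith G f X)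
    {t : ℕ} (h1 : 1 ≤ t) (ht : t ≤ T) : (argminSet f (S t)).Nonempty := by
  have hc : IsCompact (S t) := Metric.isCompact_of_isClosed_isBounded (hI.isClosed_S t h1 ht)
    (hI.isBounded_X.subset (hI.S_subset_X h1 ht))
  obtain ⟨z, hz, hmin⟩ := hc.exists_isMinOn (hI.nonempty_S t h1 ht)
    (hG.continuousOn.mono (hI.S_subset_X h1 ht))
  exact ⟨z, hz, fun y hy => hmin hy⟩

theorem minValue_le (hI : IsInstance X f S x₀ T) {G : ℝ≥0} (hG : LipschitzOnWith G f X)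
    {t : ℕ} (h1 : 1 ≤ t) (ht : t ≤ T) {y : Space d} (hy : y ∈ S t) : minValue f (S t) ≤ f y := by
  obtain ⟨z, hz⟩ := hI.argminSet_nonempty hG h1 ht
  rw [minValue_eq hz]
  exact hz.2 y hy

theorem minValue_mono (hI : IsInstance X f S x₀ T) {G : ℝ≥0} (hG : LipschitzOnWith G f X)
    {s t : ℕ} (hs : 1 ≤ s) (hst : s ≤ t) (ht : t ≤ T) : minValue f (S s) ≤ minValue f (S t) := by
  obtain ⟨z, hz⟩ := hI.argminSet_nonempty hG (hs.trans hst) ht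
  rw [minValue_eq hz]
  exact hI.minValue_le hG hs (hst.trans ht) (hI.S_subset_S hs hst ht hz.1)

/-- In sublevel form, closedness and convexity of the minimizer set follow from continuity and
convexity of f. -/
theorem argminSet_eq (hI : IsInstance X f S x₀ T) {G : ℝ≥0} (hG : LipschitzOnWith G f X)
    {t : ℕ} (h1 : 1 ≤ t) (ht : t ≤ T) :
    argminSet f (S t) = S t ∩ {y | f y ≤ minValue f (S t)} := by
  ext y
  refine ⟨fun hy => ⟨hy.1, (minValue_eq hy).ge⟩, fun hy => ⟨hy.1, fun w hw => ?_⟩⟩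
  exact hy.2.trans (hI.minValue_le hG h1 ht hw)

theorem isClosed_argminSet (hI : IsInstance X f S x₀ T) {G : ℝ≥0} (hG : LipschitzOnWith G f X)
    {t : ℕ} (h1 : 1 ≤ t) (ht : t ≤ T) : IsClosed (argminSet f (S t)) := by
  rw [hI.argminSet_eq hG h1 ht]
  exact (hG.continuousOn.mono (hI.S_subset_X h1 ht)).preimage_isClosed_of_isClosed
    (hI.isClosed_S t h1 ht) isClosed_Iic

theorem convex_argminSet (hI : IsInstance X f S x₀ T) {G : ℝ≥0} (hG : LipschitzOnWith G f X)
    {t : ℕ} (h1 : 1 ≤ t) (ht : t ≤ T) : Convex ℝ (argminSet f (S t)) := by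
  rw [hI.argminSet_eq hG h1 ht]
  exact (hI.convexOn_f.subset (hI.S_subset_X h1 ht) (hI.convex_S t h1 ht)).convex_le _

end IsInstance

/-! ### FRUGAL: lazy stretches and the cause of a jump -/

section frugal

variable {d : ℕ}

/-- FRUGAL does not play the lazy action at time `t`. -/
def IsJump (f : Space d → ℝ) (S : ℕ → Set (Space d)) (x₀ : Space d) (t : ℕ) : Prop :=
  ¬ LazyOK f S t (frugalState f S x₀ (t - 1)).1 (frugalState f S x₀ (t - 1)).2

open Classical in
/-- The last jump time up to `t`, or `0`. -/
noncomputable def lastJump (f : Space d → ℝ) (S : ℕ → Set (Space d)) (x₀ : Space d) : ℕ → ℕ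
  | 0 => 0
  | t + 1 => if IsJump f S x₀ (t + 1) then t + 1 else lastJump f S x₀ t

variable {f : Space d → ℝ} {S : ℕ → Set (Space d)} {x₀ : Space d}

theorem lastJump_succ_of_isJump {t : ℕ} (h : IsJump f S x₀ (t + 1)) :
    lastJump f S x₀ (t + 1) = t + 1 := if_pos h

theorem lastJump_succ_of_not_isJump {t : ℕ} (h : ¬ IsJump f S x₀ (t + 1)) :
    lastJump f S x₀ (t + 1) = lastJump f S x₀ t := if_neg h

theorem lastJump_le (t : ℕ) : lastJump f S x₀ t ≤ t := by
  induction t with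
  | zero => exact le_rfl
  | succ t ih =>
    by_cases h : IsJump f S x₀ (t + 1)
    · rw [lastJump_succ_of_isJump h]
    · rw [lastJump_succ_of_not_isJump h]
      omega

theorem not_isJump_of_lastJump_lt {t j : ℕ} (h1 : lastJump f S x₀ t < j) (h2 : j ≤ t) :
    ¬ IsJump f S x₀ j := by
  induction t with
  | zero => omega
  | succ t ih =>
    by_cases h : IsJump f S x₀ (t + 1)
    · rw [lastJump_succ_of_isJump h] at h1
      omega
    · rw [lastJump_succ_of_not_isJump h] at h1
      rcases h2.eq_or_lt with rfl | h3
      · exact h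
      · exact ih h1 (by omega)

theorem le_lastJump {s t : ℕ} (hs : IsJump f S x₀ s) (hst : s ≤ t) : s ≤ lastJump f S x₀ t :=
  not_lt.1 fun h => not_isJump_of_lastJump_lt h hst hs

theorem isJump_lastJump {t : ℕ} (h : 1 ≤ lastJump f S x₀ t) :
    IsJump f S x₀ (lastJump f S x₀ t) := by
  induction t with
  | zero => exact absurd h (by simp [lastJump])
  | succ t ih =>
    by_cases hj : IsJump f S x₀ (t + 1)
    · rwa [lastJump_succ_of_isJump hj]
    · rw [lastJump_succ_of_not_isJump hj] at h ⊢
      exact ih h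

theorem frugal_succ_of_not_isJump {t : ℕ} (h : ¬ IsJump f S x₀ (t + 1)) :
    frugal f S x₀ (t + 1) = proj (S (t + 1)) (frugal f S x₀ t) :=
  if_pos (not_not.1 h)

theorem frugal_succ_of_isJump {t : ℕ} (h : IsJump f S x₀ (t + 1)) :
    frugal f S x₀ (t + 1) = proj (argminSet f (S (t + 1))) (frugal f S x₀ t) :=
  if_neg h

theorem frugalState_succ_snd (t : ℕ) :
    (frugalState f S x₀ (t + 1)).2 = (frugalState f S x₀ t).2 + f (frugal f S x₀ (t + 1)) := rfl

variable {X : Set (Space d)} {T : ℕ} {G : ℝ≥0}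

theorem frugal_mem_argminSet (hI : IsInstance X f S x₀ T) (hG : LipschitzOnWith G f X) {t : ℕ}
    (h1 : 1 ≤ t) (ht : t ≤ T) (hj : IsJump f S x₀ t) :
    frugal f S x₀ t ∈ argminSet f (S t) := by
  obtain ⟨t, rfl⟩ := Nat.exists_eq_add_of_le' h1
  rw [frugal_succ_of_isJump hj]
  exact proj_mem (hI.argminSet_nonempty hG h1 ht) (hI.isClosed_argminSet hG h1 ht) _

theorem frugal_mem (hI : IsInstance X f S x₀ T) (hG : LipschitzOnWith G f X) {t : ℕ}
    (h1 : 1 ≤ t) (ht : t ≤ T) : frugal f S x₀ t ∈ S t := by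
  by_cases hj : IsJump f S x₀ t
  · exact (frugal_mem_argminSet hI hG h1 ht hj).1
  · obtain ⟨t, rfl⟩ := Nat.exists_eq_add_of_le' h1
    rw [frugal_succ_of_not_isJump hj]
    exact proj_mem (hI.nonempty_S _ h1 ht) (hI.isClosed_S _ h1 ht) _

theorem frugal_mem_X (hI : IsInstance X f S x₀ T) (hG : LipschitzOnWith G f X) {t : ℕ}
    (ht : t ≤ T) : frugal f S x₀ t ∈ X := by
  rcases Nat.eq_zero_or_pos t with rfl | h
  · exact hI.start_mem
  · exact hI.S_subset_X h ht (frugal_mem hI hG h ht)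

theorem norm_frugal_sub_le_diam (hI : IsInstance X f S x₀ T) (hG : LipschitzOnWith G f X) {s t : ℕ}
    (hs : s ≤ T) (ht : t ≤ T) : ‖frugal f S x₀ s - frugal f S x₀ t‖ ≤ diam X := by
  rw [← dist_eq_norm]
  exact dist_le_diam_of_mem hI.isBounded_X (frugal_mem_X hI hG hs) (frugal_mem_X hI hG ht)

/-- FRUGAL has no regret against the current minimum. -/
theorem frugalState_snd_le (hI : IsInstance X f S x₀ T) (hG : LipschitzOnWith G f X) {t : ℕ}
    (ht : t ≤ T) : (frugalState f S x₀ t).2 ≤ t * minValue f (S t) := by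
  induction t with
  | zero => simp [frugalState]
  | succ t ih =>
    rw [frugalState_succ_snd]
    by_cases hj : IsJump f S x₀ (t + 1)
    · rw [← minValue_eq (frugal_mem_argminSet hI hG (by omega) ht hj)]
      have h1 := ih (by omega)
      have h2 : (t : ℝ) * minValue f (S t) ≤ t * minValue f (S (t + 1)) := by
        -- `S 0` is unconstrained, so monotonicity of the minimum values is available only for t ≥
        -- 1; for t = 0 the factor t vanishes.
        rcases Nat.eq_zero_or_pos t with rfl | h
        · simp
        · have := hI.minValue_mono hG h (Nat.le_succ t) ht
          gcongr
      push_cast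
      linarith
    · rw [frugal_succ_of_not_isJump hj]
      exact not_not.1 hj

/-- By nestedness z belongs to every set projected onto, and a projection never increases the
distance to a point of its target. -/
theorem norm_frugal_sub_le_of_lazy (hI : IsInstance X f S x₀ T) {s j t : ℕ} (hsj : s ≤ j)
    (hjt : j ≤ t) (ht : t ≤ T) (hl : ∀ i, s < i → i ≤ j → ¬ IsJump f S x₀ i) {z : Space d}
    (hz : z ∈ S t) : ‖frugal f S x₀ j - z‖ ≤ ‖frugal f S x₀ s - z‖ := by
  induction j, hsj using Nat.le_induction with
  | base => exact le_rfl
  | succ j hsj ih =>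
    rw [frugal_succ_of_not_isJump (hl _ (by omega) le_rfl)]
    refine (norm_proj_sub_le (hI.nonempty_S _ ?_ ?_) (hI.isClosed_S _ ?_ ?_)
      (hI.convex_S _ ?_ ?_) _ (hI.S_subset_S ?_ hjt ht hz)).trans
      (ih (by omega) fun i h1 h2 => hl i h1 (by omega)) <;> omega

/-- Later iterates of a lazy stretch remain feasible for the earlier projections, so the stretch is
self-contracted. -/
theorem pathLength_frugal_le_of_lazy (hI : IsInstance X f S x₀ T) (hG : LipschitzOnWith G f X)
    {s t : ℕ} (hst : s ≤ t) (ht : t ≤ T) (hl : ∀ i, s < i → i ≤ t → ¬ IsJump f S x₀ i) :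
    pathLength (frugal f S x₀) s t ≤ lengthConst d * ‖frugal f S x₀ s - frugal f S x₀ t‖ :=
  pathLength_le_of_selfContracted _ hst fun m n hm hmn hn =>
    norm_frugal_sub_le_of_lazy hI (Nat.le_succ m) hmn (hn.trans ht)
      (fun i h1 h2 => hl i (by omega) (by omega)) (frugal_mem hI hG (by omega) (hn.trans ht))

/-- A jump is caused by a large loss since time `s`. -/
theorem mul_minValue_sub_lt (hI : IsInstance X f S x₀ T) (hG : LipschitzOnWith G f X)
    {s t : ℕ} (hst : s ≤ t) (ht : t + 1 ≤ T)
    (hl : ∀ i, s < i → i ≤ t → ¬ IsJump f S x₀ i) (hj : IsJump f S x₀ (t + 1)) :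
    s * (minValue f (S (t + 1)) - minValue f (S s)) <
      ((t + 1 : ℕ) - s : ℝ) * G * ‖frugal f S x₀ s - frugal f S x₀ (t + 1)‖ := by
  have hz := frugal_mem_argminSet hI hG (by omega) ht hj
  set z := frugal f S x₀ (t + 1)
  set R := ‖frugal f S x₀ s - z‖
  have hzX : z ∈ X := hI.S_subset_X (by omega) ht hz.1
  have hloss : ∀ w ∈ X, ‖w - z‖ ≤ R → f w ≤ minValue f (S (t + 1)) + G * R := by
    intro w hw hwR
    have h1 := hG.dist_le_mul w hw z hzX
    rw [Real.dist_eq, dist_eq_norm] at h1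
    have h2 := (abs_le.1 h1).2
    have h3 : (G : ℝ) * ‖w - z‖ ≤ G * R := by gcongr
    rw [minValue_eq hz]
    linarith
  have hF : ∀ j, s ≤ j → j ≤ t → (frugalState f S x₀ j).2 ≤ (frugalState f S x₀ s).2 +
      (j - s : ℝ) * (minValue f (S (t + 1)) + G * R) := by
    intro j hsj
    induction j, hsj using Nat.le_induction with
    | base => simp
    | succ j hsj ih =>
      intro hjt
      have h1 := ih (by omega)
      have h2 := hloss _ (frugal_mem_X hI hG (by omega : j + 1 ≤ T))
        (norm_frugal_sub_le_of_lazy hI (by omega) (by omega) ht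
          (fun i h1 h2 => hl i h1 (h2.trans hjt)) hz.1)
      rw [frugalState_succ_snd]
      push_cast
      linarith
  have h1 := hF t hst le_rfl
  have h2 := frugalState_snd_le hI hG (show s ≤ T by omega)
  have hne := hI.nonempty_S (t + 1) (by omega) ht
  have hcl := hI.isClosed_S (t + 1) (by omega) ht
  have h3 := hloss (proj (S (t + 1)) (frugal f S x₀ t))
    (hI.S_subset_X (by omega) ht (proj_mem hne hcl _))
    ((norm_proj_sub_le hne hcl (hI.convex_S (t + 1) (by omega) ht) _ hz.1).trans
      (norm_frugal_sub_le_of_lazy hI hst (by omega) ht hl hz.1))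
  -- The failed test. Against it stand F_s ≤ s v_s and the t+1-s lazy costs after s, including the
  -- rejected one, each at most v_{t+1} + GR.
  have h4 : ((t + 1 : ℕ) : ℝ) * minValue f (S (t + 1)) <
      (frugalState f S x₀ t).2 + f (proj (S (t + 1)) (frugal f S x₀ t)) := not_le.1 hj
  push_cast at h4 ⊢
  linarith

end frugal

/-! ### Phases of close jump times -/

section phase

variable {d : ℕ} {f : Space d → ℝ} {S : ℕ → Set (Space d)} {x₀ : Space d} {X : Set (Space d)}
  {T : ℕ} {G : ℝ≥0} {α : ℝ}

/-- FRUGAL's action at the last jump time up to `t`. -/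
noncomputable def jumpPoint (f : Space d → ℝ) (S : ℕ → Set (Space d)) (x₀ : Space d) (t : ℕ) :
    Space d :=
  frugal f S x₀ (lastJump f S x₀ t)

theorem jumpPoint_succ_of_isJump {t : ℕ} (h : IsJump f S x₀ (t + 1)) :
    jumpPoint f S x₀ (t + 1) = frugal f S x₀ (t + 1) := by
  rw [jumpPoint, lastJump_succ_of_isJump h]

theorem jumpPoint_succ_of_not_isJump {t : ℕ} (h : ¬ IsJump f S x₀ (t + 1)) :
    jumpPoint f S x₀ (t + 1) = jumpPoint f S x₀ t := by
  rw [jumpPoint, lastJump_succ_of_not_isJump h, jumpPoint]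

/-- If the jump times from `s` to `r` are close to each other, then the minimum values grow slowly
compared with the movement between the jump points. -/
theorem minValue_lastJump_sub_le (hI : IsInstance X f S x₀ T) (hG : LipschitzOnWith G f X)
    {ε : ℝ} {s r : ℕ} (hs : 1 ≤ s) (hjs : IsJump f S x₀ s) (hr : r ≤ T)
    (hclose : ∀ t, s < t → t ≤ r → IsJump f S x₀ t → (t - s : ℝ) * G ≤ ε * α * s)
    {m n : ℕ} (hsm : s ≤ m) (hmn : m ≤ n) (hnr : n ≤ r) :
    minValue f (S (lastJump f S x₀ n)) - minValue f (S (lastJump f S x₀ m)) ≤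
      ε * α * pathLength (jumpPoint f S x₀) m n := by
  induction n, hmn using Nat.le_induction with
  | base => simp [pathLength_self]
  | succ n hmn ih =>
    have h1 := ih (by omega)
    rw [pathLength_succ _ hmn]
    by_cases hj : IsJump f S x₀ (n + 1)
    · rw [lastJump_succ_of_isJump hj, jumpPoint_succ_of_isJump hj, jumpPoint]
      have hsJ : s ≤ lastJump f S x₀ n := le_lastJump hjs (hsm.trans hmn)
      have hJn := lastJump_le (f := f) (S := S) (x₀ := x₀) n
      have h2 := mul_minValue_sub_lt hI hG hJn (hnr.trans hr)
        (fun i h1 h2 => not_isJump_of_lastJump_lt h1 h2) hj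
      set J := lastJump f S x₀ n
      have h3 := hclose (n + 1) (by omega) hnr hj
      rw [norm_sub_rev]
      set R := ‖frugal f S x₀ J - frugal f S x₀ (n + 1)‖
      have hsJ' : (s : ℝ) ≤ J := by exact_mod_cast hsJ
      have hs0 : (1 : ℝ) ≤ s := by exact_mod_cast hs
      have hn0 : (s : ℝ) ≤ (n + 1 : ℕ) := by exact_mod_cast (by omega : s ≤ n + 1)
      -- No sign of ε or α is assumed; nonnegativity of the product is read off `hclose` at the jump
      -- n+1.
      have hεα : 0 ≤ ε * α := by
        have : 0 ≤ ε * α * s := le_trans (mul_nonneg (sub_nonneg.2 hn0) G.2) h3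
        exact nonneg_of_mul_nonneg_left this (by linarith)
      have h4 : ((n + 1 : ℕ) - J : ℝ) * G ≤ ε * α * J :=
        calc ((n + 1 : ℕ) - J : ℝ) * G ≤ ((n + 1 : ℕ) - s : ℝ) * G := by gcongr
          _ ≤ ε * α * s := h3
          _ ≤ ε * α * J := by gcongr
      have h5 : (J : ℝ) * (minValue f (S (n + 1)) - minValue f (S J)) ≤ J * (ε * α * R) := by
        refine h2.le.trans ?_
        have : ((n + 1 : ℕ) - J : ℝ) * G * R ≤ ε * α * J * R := by gcongr
        linarith
      have h6 := le_of_mul_le_mul_left h5 (by linarith)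
      linarith
    · rw [lastJump_succ_of_not_isJump hj, jumpPoint_succ_of_not_isJump hj, sub_self, norm_zero,
        add_zero]
      exact h1

/-- During a phase of close jump times, the jump points are almost self-contracted. -/
theorem norm_jumpPoint_sub_sq_le (hI : IsInstance X f S x₀ T) (hL : IsLipschitzSharp G α X f S T)
    {ε : ℝ} {s r : ℕ} (hs : 1 ≤ s) (hjs : IsJump f S x₀ s) (hr : r ≤ T)
    (hclose : ∀ t, s < t → t ≤ r → IsJump f S x₀ t → (t - s : ℝ) * G ≤ ε * α * s)
    {m n : ℕ} (hsm : s ≤ m) (hmn : m < n) (hnr : n ≤ r) :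
    ‖jumpPoint f S x₀ (m + 1) - jumpPoint f S x₀ n‖ ^ 2 ≤
      ‖jumpPoint f S x₀ m - jumpPoint f S x₀ n‖ ^ 2 +
        2 * ε * pathLength (jumpPoint f S x₀) (m + 1) n *
          ‖jumpPoint f S x₀ (m + 1) - jumpPoint f S x₀ m‖ := by
  have hG := hL.lipschitz
  by_cases hj : IsJump f S x₀ (m + 1)
  · obtain ⟨hα, hsharp⟩ := hL.sharp (m + 1) (by omega) (by omega)
    have hgrow := minValue_lastJump_sub_le hI hG hs hjs hr hclose (by omega : s ≤ m + 1) hmn hnr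
    rw [lastJump_succ_of_isJump hj] at hgrow
    have hmN : m + 1 ≤ lastJump f S x₀ n := le_lastJump hj hmn
    have hNn := lastJump_le (f := f) (S := S) (x₀ := x₀) n
    have hzN := frugal_mem_argminSet hI hG (by omega) (by omega)
      (isJump_lastJump (show 1 ≤ lastJump f S x₀ n by omega))
    have hne := hI.argminSet_nonempty hG (show 1 ≤ m + 1 by omega) (by omega)
    have hcl := hI.isClosed_argminSet hG (show 1 ≤ m + 1 by omega) (by omega)
    have hcv := hI.convex_argminSet hG (show 1 ≤ m + 1 by omega) (by omega)
    have hzm := hI.S_subset_S (by omega) hmN (by omega) hzN.1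
    have hJm := lastJump_le (f := f) (S := S) (x₀ := x₀) m
    have hlazy := fun i (h1 : lastJump f S x₀ m < i) (h2 : i ≤ m) => not_isJump_of_lastJump_lt h1 h2
    have hp := frugal_mem_argminSet hI hG (by omega) (by omega) hj
    have hpe := frugal_succ_of_isJump hj
    rw [jumpPoint_succ_of_isJump hj]
    change ‖frugal f S x₀ (m + 1) - frugal f S x₀ (lastJump f S x₀ n)‖ ^ 2 ≤
      ‖frugal f S x₀ (lastJump f S x₀ m) - frugal f S x₀ (lastJump f S x₀ n)‖ ^ 2 + 2 * ε *
        pathLength (jumpPoint f S x₀) (m + 1) n *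
          ‖frugal f S x₀ (m + 1) - frugal f S x₀ (lastJump f S x₀ m)‖
    have hval := minValue_eq hzN
    set z := frugal f S x₀ (lastJump f S x₀ n)
    -- Sharpness over S (m+1) bounds the distance from the later jump point z to the minimizer set
    -- by the growth of the minimum value divided by α.
    obtain ⟨w, hw, hwz⟩ := hcl.exists_infDist_eq_dist hne z
    have h1 := hsharp z hzm
    rw [hwz, dist_eq_norm, ← hval] at h1
    have h2 : ‖z - w‖ ≤ ε * pathLength (jumpPoint f S x₀) (m + 1) n := by
      refine le_of_mul_le_mul_left ?_ hα
      linarith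
    have h3 := norm_proj_sub_sq_le hne hcl hcv (frugal f S x₀ m) z hw
    rw [← hpe] at h3
    -- The projection starts from x_m, not from the last jump point. Both z and the new jump point
    -- lie in S (m+1), so replacing x_m by the last jump point only increases the two distances.
    have h4 := norm_frugal_sub_le_of_lazy hI hJm (by omega) (by omega : m + 1 ≤ T) hlazy hzm
    have h5 := norm_frugal_sub_le_of_lazy hI hJm (by omega) (by omega : m + 1 ≤ T) hlazy hp.1
    rw [norm_sub_rev (frugal f S x₀ (m + 1)) (frugal f S x₀ (lastJump f S x₀ m))]
    have h6 := (norm_nonneg _).trans h2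
    calc _ ≤ _ := h3
      _ ≤ ‖frugal f S x₀ (lastJump f S x₀ m) - z‖ ^ 2 +
          2 * (ε * pathLength (jumpPoint f S x₀) (m + 1) n) *
            ‖frugal f S x₀ (lastJump f S x₀ m) - frugal f S x₀ (m + 1)‖ := by gcongr
      _ = _ := by ring
  · rw [jumpPoint_succ_of_not_isJump hj, sub_self, norm_zero, mul_zero, add_zero]

/-- FRUGAL's movement up to the last jump is controlled by that of the jump points. -/
theorem pathLength_frugal_lastJump_le (hI : IsInstance X f S x₀ T) (hG : LipschitzOnWith G f X)
    {s r : ℕ} (hs : 1 ≤ s) (hjs : IsJump f S x₀ s) (hsr : s ≤ r) (hr : r ≤ T) :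
    pathLength (frugal f S x₀) s (lastJump f S x₀ r) ≤
      (2 * lengthConst d + 1) * pathLength (jumpPoint f S x₀) s r := by
  induction r, hsr using Nat.le_induction with
  | base =>
    obtain ⟨s, rfl⟩ := Nat.exists_eq_add_of_le' hs
    rw [lastJump_succ_of_isJump hjs, pathLength_self, pathLength_self, mul_zero]
  | succ r hsr ih =>
    have h1 := ih (by omega)
    rw [pathLength_succ _ hsr]
    by_cases hj : IsJump f S x₀ (r + 1)
    · have hsJ : s ≤ lastJump f S x₀ r := le_lastJump hjs hsr
      have hJr := lastJump_le (f := f) (S := S) (x₀ := x₀) r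
      have hlazy := fun i (h1 : lastJump f S x₀ r < i) (h2 : i ≤ r) =>
        not_isJump_of_lastJump_lt h1 h2
      rw [lastJump_succ_of_isJump hj, jumpPoint_succ_of_isJump hj, jumpPoint,
        pathLength_succ _ hsr, ← pathLength_add _ hsJ hJr]
      have h2 := pathLength_frugal_le_of_lazy hI hG hJr (by omega) hlazy
      have hp := frugal_mem hI hG (by omega) hr
      have h3 := norm_frugal_sub_le_of_lazy hI hJr (Nat.le_succ r) hr hlazy hp
      set J := lastJump f S x₀ r
      have h4 := norm_sub_le_norm_sub_add_norm_sub (frugal f S x₀ J) (frugal f S x₀ (r + 1))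
        (frugal f S x₀ r)
      rw [norm_sub_rev (frugal f S x₀ (r + 1)) (frugal f S x₀ r)] at h4
      rw [norm_sub_rev (frugal f S x₀ (r + 1)) (frugal f S x₀ r),
        norm_sub_rev (frugal f S x₀ (r + 1)) (frugal f S x₀ J)]
      have hΛ := one_le_lengthConst d
      -- The lazy stretch ends no farther from the next jump point than it began, so its chord is at
      -- most twice the jump-point step. The jump itself costs at most one more such step.
      have h5 : lengthConst d * ‖frugal f S x₀ J - frugal f S x₀ r‖ ≤
          lengthConst d * (2 * ‖frugal f S x₀ J - frugal f S x₀ (r + 1)‖) := by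
        gcongr
        linarith
      linarith
    · rw [lastJump_succ_of_not_isJump hj, jumpPoint_succ_of_not_isJump hj, sub_self, norm_zero,
        add_zero]
      exact h1

/-- The constant in the bound for FRUGAL's movement during a phase of close jump times. -/
noncomputable def phaseConst (d : ℕ) : ℝ :=
  (2 * lengthConst d + 1) * lengthConst d + lengthConst d

/-- The jump points form a line of length at most Λ times the diameter, which controls the movement
up to the last jump; the final lazy stretch adds another Λ times the diameter. -/
theorem pathLength_frugal_phase_le (hI : IsInstance X f S x₀ T) (hL : IsLipschitzSharp G α X f S T)
    {s r : ℕ} (hs : 1 ≤ s) (hjs : IsJump f S x₀ s) (hsr : s ≤ r) (hr : r ≤ T)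
    (hclose : ∀ t, s < t → t ≤ r → IsJump f S x₀ t → (t - s : ℝ) * G ≤ tolerance d * α * s) :
    pathLength (frugal f S x₀) s r ≤ phaseConst d * diam X := by
  have hG := hL.lipschitz
  have hΛ := one_le_lengthConst d
  have hsJ : s ≤ lastJump f S x₀ r := le_lastJump hjs hsr
  have hJr := lastJump_le (f := f) (S := S) (x₀ := x₀) r
  have h1 := pathLength_le (jumpPoint f S x₀) hsr fun m n hm hmn hn =>
    norm_jumpPoint_sub_sq_le hI hL hs hjs hr hclose hm hmn hn
  have h2 := pathLength_frugal_lastJump_le hI hG hs hjs hsr hr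
  have h3 := pathLength_frugal_le_of_lazy hI hG hJr hr
    fun i h1 h2 => not_isJump_of_lastJump_lt h1 h2
  have h4 : ‖jumpPoint f S x₀ s - jumpPoint f S x₀ r‖ ≤ diam X :=
    norm_frugal_sub_le_diam hI hG ((lastJump_le s).trans (hsr.trans hr)) (hJr.trans hr)
  have h5 := norm_frugal_sub_le_diam hI hG (hJr.trans hr) hr
  rw [← pathLength_add _ hsJ hJr, phaseConst]
  calc _ ≤ (2 * lengthConst d + 1) * (lengthConst d * diam X) + lengthConst d * diam X := by
        refine add_le_add (h2.trans ?_) (h3.trans ?_)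
        · gcongr
          exact h1.trans (by gcongr)
        · gcongr
    _ = _ := by ring

theorem one_le_phaseConst (d : ℕ) : 1 ≤ phaseConst d := by
  unfold phaseConst
  nlinarith [one_le_lengthConst d]

theorem lengthConst_le_phaseConst (d : ℕ) : lengthConst d ≤ phaseConst d := by
  unfold phaseConst
  nlinarith [one_le_lengthConst d]

/-- FRUGAL's movement from a jump on: the jump times split into logarithmically many phases. -/
theorem pathLength_frugal_le_of_isJump (hI : IsInstance X f S x₀ T)
    (hL : IsLipschitzSharp G α X f S T) (hα : 0 < α) (hG0 : 0 < G) {s : ℕ} (hs : 1 ≤ s)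
    (hjs : IsJump f S x₀ s) (hsT : s ≤ T) :
    pathLength (frugal f S x₀) s T ≤ (phaseConst d + 1) * diam X *
      (1 + Real.logb (1 + tolerance d * (α / G)) (T / s)) := by
  classical
  obtain ⟨N, hN⟩ : ∃ N, T - s = N := ⟨_, rfl⟩
  induction N using Nat.strong_induction_on generalizing s with
  | _ N ih =>
    have hG0' : (0 : ℝ) < G := hG0
    have hθ : 0 < tolerance d * (α / G) := mul_pos (tolerance_pos d) (by positivity)
    set b := 1 + tolerance d * (α / G) with hb
    have hb1 : 1 < b := by linarith
    have hs0 : (0 : ℝ) < s := by exact_mod_cast hs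
    have hT0 : (0 : ℝ) < T := by exact_mod_cast hs.trans hsT
    have hD : 0 ≤ diam X := diam_nonneg
    have hP := one_le_phaseConst d
    have hlog : 0 ≤ Real.logb b (T / s) :=
      Real.logb_nonneg hb1 ((one_le_div hs0).2 (by exact_mod_cast hsT))
    have hiff : ∀ t : ℕ, ¬ b * s < t → (t - s : ℝ) * G ≤ tolerance d * α * s := by
      intro t ht
      have h1 : (t - s : ℝ) * G ≤ tolerance d * (α / G) * s * G := by
        gcongr
        rw [hb] at ht
        linarith
      refine h1.trans_eq ?_
      field_simp
    -- The next phase opens at the first jump after b s. The logarithm then drops by at least 1,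
    -- which pays for the phase just ended and for the opening jump, the +1 in the constant.
    by_cases hex : ∃ t, s < t ∧ t ≤ T ∧ IsJump f S x₀ t ∧ b * s < t
    · obtain ⟨hst, htT, hjt, hbt⟩ := Nat.find_spec hex
      have hmin := fun m (hm : m < Nat.find hex) => Nat.find_min hex hm
      set t := Nat.find hex
      obtain ⟨t', ht'⟩ := Nat.exists_eq_add_of_le' (show 1 ≤ t by omega)
      have hst' : s ≤ t' := by omega
      have h1 := pathLength_frugal_phase_le hI hL hs hjs hst' (by omega) fun u hsu hu hju =>
        hiff u fun hbu => hmin u (by omega) ⟨hsu, by omega, hju, hbu⟩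
      have h2 := ih (T - t) (by omega) (by omega) hjt htT rfl
      have h3 : ‖frugal f S x₀ (t' + 1) - frugal f S x₀ t'‖ ≤ diam X :=
        norm_frugal_sub_le_diam hI hL.lipschitz (by omega) (by omega)
      have ht0 : (0 : ℝ) < t := by exact_mod_cast (by omega : 0 < t)
      have h4 : Real.logb b (T / t) + 1 ≤ Real.logb b (T / s) := by
        rw [← Real.logb_self_eq_one hb1, ← Real.logb_mul (by positivity) (by positivity)]
        refine Real.logb_le_logb_of_le hb1 (by positivity) ?_
        rw [div_mul_eq_mul_div, div_le_div_iff₀ ht0 hs0, mul_assoc]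
        gcongr
      rw [← pathLength_add _ hst.le htT, ht', pathLength_succ _ hst']
      have h5 : (phaseConst d + 1) * diam X * (1 + Real.logb b (T / t)) ≤
          (phaseConst d + 1) * diam X * Real.logb b (T / s) := by
        gcongr
        linarith
      rw [ht'] at h2 h5
      linarith
    · push Not at hex
      have h1 := pathLength_frugal_phase_le hI hL hs hjs hsT le_rfl fun u hsu hu hju =>
        hiff u (not_lt.2 (hex u hsu hu hju))
      refine h1.trans ?_
      have h2 : (phaseConst d + 1) * diam X * 1 ≤
          (phaseConst d + 1) * diam X * (1 + Real.logb b (T / s)) := by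
        gcongr
        linarith
      linarith

theorem movementCost_eq_pathLength (x : ℕ → Space d) (T : ℕ) :
    movementCost x T = pathLength x 0 T := by
  rw [movementCost, pathLength, Finset.sum_Ico_eq_sum_range, ← Finset.Ico_add_one_right_eq_Icc, Finset.sum_Ico_eq_sum_range]
  refine Finset.sum_congr (by simp) fun j _ => ?_
  rw [add_comm 1 j, Nat.add_sub_cancel, zero_add]

theorem movementCost_frugal_le (hI : IsInstance X f S x₀ T)
    (hL : IsLipschitzSharp G α X f S T) (hT : 1 ≤ T) (hα : 0 < α) (hG0 : 0 < G) :
    movementCost (frugal f S x₀) T ≤ (phaseConst d + 1) * diam X *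
      (2 + Real.logb (1 + tolerance d * (α / G)) T) := by
  classical
  rw [movementCost_eq_pathLength]
  have hG := hL.lipschitz
  have hG0' : (0 : ℝ) < G := hG0
  have hθ : 0 < tolerance d * (α / G) := mul_pos (tolerance_pos d) (by positivity)
  set b := 1 + tolerance d * (α / G) with hb
  have hb1 : 1 < b := by linarith
  have hT1 : (1 : ℝ) ≤ T := by exact_mod_cast hT
  have hlog : 0 ≤ Real.logb b T := Real.logb_nonneg hb1 hT1
  have hD : 0 ≤ diam X := diam_nonneg
  have hΛ := lengthConst_le_phaseConst d
  have hΛ1 := one_le_lengthConst d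
  -- Before the first jump all moves are lazy. This stretch together with the first jump costs one
  -- extra unit, hence 2 in place of 1.
  have hprefix : ∀ t, t ≤ T → (∀ i, 0 < i → i ≤ t → ¬ IsJump f S x₀ i) →
      pathLength (frugal f S x₀) 0 t ≤ phaseConst d * diam X := fun t ht hl => by
    refine (pathLength_frugal_le_of_lazy hI hG (Nat.zero_le t) ht hl).trans ?_
    have := norm_frugal_sub_le_diam hI hG (Nat.zero_le T) ht
    have := one_le_phaseConst d
    gcongr
  by_cases hex : ∃ t, 1 ≤ t ∧ t ≤ T ∧ IsJump f S x₀ t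
  · obtain ⟨h1t, htT, hjt⟩ := Nat.find_spec hex
    have hmin := fun m (hm : m < Nat.find hex) => Nat.find_min hex hm
    set t := Nat.find hex
    obtain ⟨t', ht'⟩ := Nat.exists_eq_add_of_le' h1t
    have h1 := hprefix t' (by omega) fun i h0 hi hji => hmin i (by omega) ⟨h0, by omega, hji⟩
    have h2 := pathLength_frugal_le_of_isJump hI hL hα hG0 h1t hjt htT
    have h3 : ‖frugal f S x₀ (t' + 1) - frugal f S x₀ t'‖ ≤ diam X :=
      norm_frugal_sub_le_diam hI hG (by omega) (by omega)
    have ht1 : (1 : ℝ) ≤ t := by exact_mod_cast h1t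
    have h4 : Real.logb b (T / t) ≤ Real.logb b T :=
      Real.logb_le_logb_of_le hb1 (by positivity) (div_le_self (by positivity) ht1)
    have h5 : (phaseConst d + 1) * diam X * (1 + Real.logb b (T / t)) ≤
        (phaseConst d + 1) * diam X * (1 + Real.logb b T) := by
      have : 0 ≤ phaseConst d + 1 := by linarith
      gcongr
    rw [← pathLength_add _ (Nat.zero_le t) htT, ht', pathLength_succ _ (Nat.zero_le t')]
    rw [ht'] at h2 h5
    linarith
  · push Not at hex
    refine (hprefix T le_rfl fun i h0 hi => hex i h0 hi).trans ?_
    have h0 : 0 ≤ (phaseConst d + 1) * diam X * (1 + Real.logb b T) := by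
      have : 0 ≤ phaseConst d + 1 := by linarith
      positivity
    linarith

/-! ### Constants and the movement bounds -/

/-- Bernoulli's inequality (1 + x)^ε ≤ 1 + εx: shrinking the phase ratio by ε costs only a factor
1/ε. -/
theorem logb_one_add_mul_le {ε x : ℝ} (hε : 0 < ε) (hε1 : ε ≤ 1) (hx : 0 < x) {t : ℝ}
    (ht : 1 ≤ t) : Real.logb (1 + ε * x) t ≤ 1 / ε * Real.logb (1 + x) t := by
  have h1 : ε * Real.log (1 + x) ≤ Real.log (1 + ε * x) := by
    rw [← Real.log_rpow (by linarith)]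
    exact Real.log_le_log (by positivity)
      (rpow_one_add_le_one_add_mul_self (by linarith) hε.le hε1)
  have h2 : 0 < Real.log (1 + x) := Real.log_pos (by linarith)
  have h3 := Real.log_nonneg ht
  calc Real.log t / Real.log (1 + ε * x) ≤ Real.log t / (ε * Real.log (1 + x)) := by gcongr
    _ = 1 / ε * (Real.log t / Real.log (1 + x)) := by field_simp

/-- Each exponential in `d` is bounded by a constant times `d ^ (d / 2)`. -/
theorem exists_pow_le_mul_rpow {b : ℝ} (hb : 1 ≤ b) :
    ∃ C : ℝ, 0 < C ∧ ∀ d : ℕ, b ^ d ≤ C * (d : ℝ) ^ ((d : ℝ) / 2) := by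
  -- From d ≥ b² on, b^d = (b²)^{d/2} ≤ d^{d/2}; the finitely many smaller d are covered by b^N.
  obtain ⟨N, hN⟩ := exists_nat_ge (b ^ 2)
  have hC : 1 ≤ b ^ N := one_le_pow₀ hb
  refine ⟨b ^ N, by positivity, fun d => ?_⟩
  rcases le_total d N with h | h
  · have h1 : (1 : ℝ) ≤ (d : ℝ) ^ ((d : ℝ) / 2) := by
      rcases Nat.eq_zero_or_pos d with rfl | hd
      · simp
      · exact Real.one_le_rpow (by exact_mod_cast hd) (by positivity)
    calc b ^ d ≤ b ^ N := pow_le_pow_right₀ hb h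
      _ ≤ _ := le_mul_of_one_le_right (by positivity) h1
  · have h1 : b ^ 2 ≤ d := hN.trans (by exact_mod_cast h)
    have h2 : b ^ d = (b ^ 2) ^ ((d : ℝ) / 2) := by
      rw [← Real.rpow_natCast b 2, ← Real.rpow_mul (by positivity), ← Real.rpow_natCast]
      congr 1
      push_cast
      ring
    calc b ^ d = (b ^ 2) ^ ((d : ℝ) / 2) := h2
      _ ≤ (d : ℝ) ^ ((d : ℝ) / 2) := Real.rpow_le_rpow (by positivity) h1 (by positivity)
      _ ≤ _ := le_mul_of_one_le_left (by positivity) hC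

theorem exists_phaseConst_le : ∃ C : ℝ, 0 < C ∧ ∀ d : ℕ,
    (phaseConst d + 1) * (3 / tolerance d) ≤ C * (d : ℝ) ^ ((d : ℝ) / 2) := by
  obtain ⟨C, hC, h⟩ := exists_pow_le_mul_rpow (b := 36 ^ 2 * 5184) (by norm_num)
  refine ⟨5 * 64 ^ 2 * 3 * 409600 * C, by positivity, fun d => ?_⟩
  have h1 : phaseConst d + 1 ≤ 5 * lengthConst d ^ 2 := by
    unfold phaseConst
    nlinarith [one_le_lengthConst d]
  have ht := tolerance_pos d
  calc (phaseConst d + 1) * (3 / tolerance d)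
      ≤ 5 * lengthConst d ^ 2 * (3 / tolerance d) := by gcongr
    _ = 5 * 64 ^ 2 * 3 * 409600 * (36 ^ 2 * 5184) ^ d := by
        rw [mul_pow (36 ^ 2 : ℝ), ← pow_mul, mul_comm 2 d, pow_mul]
        unfold lengthConst tolerance
        field_simp
    _ ≤ 5 * 64 ^ 2 * 3 * 409600 * (C * (d : ℝ) ^ ((d : ℝ) / 2)) := by
        gcongr
        exact h d
    _ = _ := by ring

/-- The movement bound with an absolute constant. -/
theorem exists_movementCost_frugal_le : ∃ C : ℝ, 0 < C ∧
    ∀ (d : ℕ) (X : Set (Space d)) (f : Space d → ℝ) (S : ℕ → Set (Space d)) (x₀ : Space d) (T : ℕ)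
      (G : ℝ≥0) (α : ℝ), 2 ≤ T → 0 < α → α ≤ G → IsInstance X f S x₀ T →
      IsLipschitzSharp G α X f S T →
      movementCost (frugal f S x₀) T ≤
        C * (d : ℝ) ^ ((d : ℝ) / 2) * diam X * Real.logb (1 + α / G) T := by
  obtain ⟨C, hC, h⟩ := exists_phaseConst_le
  refine ⟨C, hC, fun d X f S x₀ T G α hT hα hαG hI hL => ?_⟩
  have hG0 : (0 : ℝ) < G := hα.trans_le hαG
  have hx : 0 < α / G := by positivity
  have hx1 : α / G ≤ 1 := (div_le_one hG0).2 hαG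
  have hT' : (2 : ℝ) ≤ T := by exact_mod_cast hT
  -- Since 1 + α/G ≤ 2 ≤ T, the additive 2 is absorbed into the logarithm, giving the 3 in 3/ε.
  have hlog : 1 ≤ Real.logb (1 + α / G) T := by
    rw [Real.le_logb_iff_rpow_le (by linarith) (by linarith), Real.rpow_one]
    linarith
  have hε := tolerance_pos d
  have hε1 := tolerance_le_one d
  have h1 := movementCost_frugal_le hI hL (by omega) hα hG0
  have h2 := logb_one_add_mul_le hε hε1 hx (by linarith : (1 : ℝ) ≤ T)
  have h3 : 2 + Real.logb (1 + tolerance d * (α / G)) T ≤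
      3 / tolerance d * Real.logb (1 + α / G) T := by
    have h4 : 1 ≤ 1 / tolerance d := (one_le_div hε).2 hε1
    have h5 : 3 / tolerance d = 1 / tolerance d + 2 * (1 / tolerance d) := by ring
    rw [h5]
    nlinarith
  have hP := one_le_phaseConst d
  calc movementCost (frugal f S x₀) T
      ≤ (phaseConst d + 1) * diam X * (3 / tolerance d * Real.logb (1 + α / G) T) := by
        refine h1.trans ?_
        have := diam_nonneg (s := X)
        gcongr
    _ = (phaseConst d + 1) * (3 / tolerance d) * (diam X * Real.logb (1 + α / G) T) := by ring
    _ ≤ C * (d : ℝ) ^ ((d : ℝ) / 2) * (diam X * Real.logb (1 + α / G) T) := by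
        have := diam_nonneg (s := X)
        exact mul_le_mul_of_nonneg_right (h d) (by positivity)
    _ = _ := by ring

theorem IsLipschitzSharp.mono {G' : ℝ≥0} (hL : IsLipschitzSharp G α X f S T) (h : G ≤ G') :
    IsLipschitzSharp G' α X f S T :=
  ⟨hL.lipschitz.weaken h, hL.sharp⟩

/-- The movement is logarithmic in the horizon. -/
theorem exists_movementCost_frugal_le_log (d : ℕ) (D : ℝ) (G : ℝ≥0) (α : ℝ) (hα : 0 < α) :
    ∃ C : ℝ, 0 < C ∧
      ∀ (X : Set (Space d)) (f : Space d → ℝ) (S : ℕ → Set (Space d)) (x₀ : Space d) (T : ℕ),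
        2 ≤ T → diam X ≤ D → IsInstance X f S x₀ T → IsLipschitzSharp G α X f S T →
        movementCost (frugal f S x₀) T ≤ C * Real.log T := by
  obtain ⟨C, hC, h⟩ := exists_movementCost_frugal_le
  -- α may exceed G, for instance when f is constant; enlarging the Lipschitz constant restores α ≤
  -- G'.
  set G' : ℝ≥0 := G ⊔ α.toNNReal
  have hαG : α ≤ G' := (Real.le_coe_toNNReal α).trans (NNReal.coe_le_coe.2 le_sup_right)
  have hG0 : (0 : ℝ) < G' := hα.trans_le hαG
  have hlog : 0 < Real.log (1 + α / G') := Real.log_pos (by linarith [div_pos hα hG0])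
  have hd : (0 : ℝ) ≤ (d : ℝ) ^ ((d : ℝ) / 2) := by positivity
  -- The absolute value and the +1 keep the constant positive for every real D, including D ≤ 0.
  refine ⟨C * (d : ℝ) ^ ((d : ℝ) / 2) * |D| / Real.log (1 + α / G') + 1, by positivity,
    fun X f S x₀ T hT hD hI hL => ?_⟩
  have hT' : 0 ≤ Real.log T := Real.log_natCast_nonneg T
  calc movementCost (frugal f S x₀) T
      ≤ C * (d : ℝ) ^ ((d : ℝ) / 2) * diam X * (Real.log T / Real.log (1 + α / G')) :=
        h d X f S x₀ T G' α hT hα hαG hI (hL.mono le_sup_left)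
    _ ≤ C * (d : ℝ) ^ ((d : ℝ) / 2) * |D| * (Real.log T / Real.log (1 + α / G')) := by
        have := hD.trans (le_abs_self D)
        gcongr
    _ = C * (d : ℝ) ^ ((d : ℝ) / 2) * |D| / Real.log (1 + α / G') * Real.log T := by ring
    _ ≤ _ := by nlinarith

/-! ### Unique minimizers: counting jumps -/

/-- With unique minimizers, the jump times grow geometrically. -/
theorem mul_lt_of_isJump (hI : IsInstance X f S x₀ T) (hL : IsLipschitzSharp G α X f S T)
    (hG0 : 0 < G) (huniq : ∀ t, 1 ≤ t → t ≤ T → (argminSet f (S t)).Subsingleton)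
    {s t : ℕ} (hs : 1 ≤ s) (hjs : IsJump f S x₀ s) (hst : s ≤ t) (ht : t + 1 ≤ T)
    (hjt : IsJump f S x₀ (t + 1)) :
    (1 + α / G) * (lastJump f S x₀ t : ℝ) < (t + 1 : ℕ) := by
  have hG := hL.lipschitz
  have hG0' : (0 : ℝ) < G := hG0
  have hsJ : s ≤ lastJump f S x₀ t := le_lastJump hjs hst
  have hJt := lastJump_le (f := f) (S := S) (x₀ := x₀) t
  have h1 := mul_minValue_sub_lt hI hG hJt ht (fun i h1 h2 => not_isJump_of_lastJump_lt h1 h2) hjt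
  have hjJ := isJump_lastJump (hs.trans hsJ)
  set J := lastJump f S x₀ t
  have hJ := frugal_mem_argminSet hI hG (hs.trans hsJ) (by omega) hjJ
  have hz := frugal_mem_argminSet hI hG (by omega) ht hjt
  have h2 := (hL.sharp J (by omega) (by omega)).2 _
    (hI.S_subset_S (hs.trans hsJ) (by omega) ht hz.1)
  -- By uniqueness, the distance in the sharpness inequality is the distance R to the jump point
  -- itself, the same R as in `h1`, so it cancels.
  have hsing : argminSet f (S J) = {frugal f S x₀ J} :=
    (huniq J (by omega) (by omega)).eq_singleton_of_mem hJ
  rw [hsing, infDist_singleton, dist_comm, dist_eq_norm, ← minValue_eq hz] at h2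
  set R := ‖frugal f S x₀ J - frugal f S x₀ (t + 1)‖
  have h3 : (J : ℝ) * (α * R) < ((t + 1 : ℕ) - J : ℝ) * G * R :=
    lt_of_le_of_lt (by gcongr) h1
  have h4 : (J : ℝ) * α < ((t + 1 : ℕ) - J : ℝ) * G := by
    rw [← mul_assoc] at h3
    exact lt_of_mul_lt_mul_right h3 (norm_nonneg _)
  have h5 : (J : ℝ) * α / G < (t + 1 : ℕ) - J := (div_lt_iff₀ hG0').2 h4
  have h6 : (1 + α / G) * (J : ℝ) = J + J * α / G := by ring
  linarith

theorem mem_frugalJumps {t : ℕ} :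
    t ∈ frugalJumps f S x₀ T ↔ 1 ≤ t ∧ t ≤ T ∧ IsJump f S x₀ t := Iff.rfl

theorem finite_frugalJumps (T : ℕ) : (frugalJumps f S x₀ T).Finite :=
  (Set.finite_Icc 1 T).subset fun _ ht => ⟨ht.1, ht.2.1⟩

theorem frugalJumps_succ_of_not_isJump {t : ℕ} (h : ¬ IsJump f S x₀ (t + 1)) :
    frugalJumps f S x₀ (t + 1) = frugalJumps f S x₀ t := by
  ext j
  rw [mem_frugalJumps, mem_frugalJumps]
  refine ⟨fun ⟨h1, h2, h3⟩ => ⟨h1, ?_, h3⟩, fun ⟨h1, h2, h3⟩ => ⟨h1, by omega, h3⟩⟩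
  rcases h2.eq_or_lt with rfl | h4
  · exact absurd h3 h
  · omega

theorem frugalJumps_succ_of_isJump {t : ℕ} (h : IsJump f S x₀ (t + 1)) :
    frugalJumps f S x₀ (t + 1) = insert (t + 1) (frugalJumps f S x₀ t) := by
  ext j
  rw [Set.mem_insert_iff, mem_frugalJumps, mem_frugalJumps]
  constructor
  · rintro ⟨h1, h2, h3⟩
    rcases h2.eq_or_lt with h4 | h4
    · exact Or.inl h4
    · exact Or.inr ⟨h1, by omega, h3⟩
  · rintro (rfl | ⟨h1, h2, h3⟩)
    · exact ⟨by omega, le_rfl, h⟩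
    · exact ⟨h1, by omega, h3⟩

/-- With unique minimizers, the number of jumps is logarithmic in the last jump time. -/
theorem pow_ncard_frugalJumps_le (hI : IsInstance X f S x₀ T) (hL : IsLipschitzSharp G α X f S T)
    (hα : 0 < α) (hG0 : 0 < G)
    (huniq : ∀ t, 1 ≤ t → t ≤ T → (argminSet f (S t)).Subsingleton) {r : ℕ} (hr : r ≤ T)
    (hne : (frugalJumps f S x₀ r).Nonempty) :
    (1 + α / G) ^ ((frugalJumps f S x₀ r).ncard - 1) ≤ (lastJump f S x₀ r : ℝ) := by
  induction r with
  | zero =>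
    obtain ⟨t, ht⟩ := hne
    exact absurd (ht.1.trans ht.2.1) (by omega)
  | succ r ih =>
    by_cases hj : IsJump f S x₀ (r + 1)
    · have hnot : r + 1 ∉ frugalJumps f S x₀ r := fun h => absurd h.2.1 (by omega)
      rw [lastJump_succ_of_isJump hj, frugalJumps_succ_of_isJump hj,
        Set.ncard_insert_of_notMem hnot (finite_frugalJumps r), Nat.add_sub_cancel]
      rcases (frugalJumps f S x₀ r).eq_empty_or_nonempty with h0 | h0
      · rw [h0, Set.ncard_empty, pow_zero]
        exact_mod_cast Nat.succ_le_succ (Nat.zero_le r)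
      · have h1 := ih (by omega) h0
        have hpos := (Set.ncard_pos (finite_frugalJumps r)).2 h0
        obtain ⟨s, hs⟩ := h0
        have h2 := mul_lt_of_isJump hI hL hG0 huniq hs.1 hs.2.2 hs.2.1 hr hj
        obtain ⟨k, hk⟩ := Nat.exists_eq_add_of_le' hpos
        rw [hk] at h1 ⊢
        rw [Nat.add_sub_cancel] at h1
        have hx : (0 : ℝ) ≤ 1 + α / G := by positivity
        calc (1 + α / G) ^ (k + 1) = (1 + α / G) * (1 + α / G) ^ k := pow_succ' _ _
          _ ≤ (1 + α / G) * lastJump f S x₀ r := by gcongr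
          _ ≤ _ := h2.le
    · rw [lastJump_succ_of_not_isJump hj]
      rw [frugalJumps_succ_of_not_isJump hj] at hne ⊢
      exact ih (by omega) hne

end phase

end CONES

theorem mainTheorem3 :
    -- the movement cost bound, with an absolute constant
    (∃ C : ℝ, 0 < C ∧
      ∀ (d : ℕ) (X : Set (CONES.Space d)) (f : CONES.Space d → ℝ) (S : ℕ → Set (CONES.Space d))
        (x₀ : CONES.Space d) (T : ℕ) (G : ℝ≥0) (α : ℝ),
        2 ≤ T → 0 < α → α ≤ G →
        CONES.IsInstance X f S x₀ T → CONES.IsLipschitzSharp G α X f S T →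
        CONES.movementCost (CONES.frugal f S x₀) T ≤
          C * (d : ℝ) ^ ((d : ℝ) / 2) * Metric.diam X * Real.logb (1 + α / G) T) ∧
    -- it is logarithmic in `T`, with a constant depending on `d, D, G, α` only
    (∀ (d : ℕ) (D : ℝ) (G : ℝ≥0) (α : ℝ), 0 < α →
      ∃ C : ℝ, 0 < C ∧
        ∀ (X : Set (CONES.Space d)) (f : CONES.Space d → ℝ) (S : ℕ → Set (CONES.Space d))
          (x₀ : CONES.Space d) (T : ℕ),
          2 ≤ T → Metric.diam X ≤ D →
          CONES.IsInstance X f S x₀ T → CONES.IsLipschitzSharp G α X f S T →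
          CONES.movementCost (CONES.frugal f S x₀) T ≤ C * Real.log T) ∧
    -- for unique minimizers: geometric growth of the jump times and the number of jumps
    (∀ (d : ℕ) (X : Set (CONES.Space d)) (f : CONES.Space d → ℝ) (S : ℕ → Set (CONES.Space d))
      (x₀ : CONES.Space d) (T : ℕ) (G : ℝ≥0) (α : ℝ),
      1 ≤ T → 0 < α → α ≤ G →
      CONES.IsInstance X f S x₀ T → CONES.IsLipschitzSharp G α X f S T →
      (∀ t, 1 ≤ t → t ≤ T → (CONES.argminSet f (S t)).Subsingleton) →
      (∀ s ∈ CONES.frugalJumps f S x₀ T, ∀ t ∈ CONES.frugalJumps f S x₀ T, s < t →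
        (1 + α / G) * (s : ℝ) < t) ∧
      ((CONES.frugalJumps f S x₀ T).ncard : ℝ) ≤
        (⌈(G : ℝ) / α⌉₊ : ℝ) + 1 + Real.logb (1 + α / G) T) := by
  refine ⟨CONES.exists_movementCost_frugal_le, CONES.exists_movementCost_frugal_le_log, ?_⟩
  intro d X f S x₀ T G α hT hα hαG hI hL huniq
  have hG0 : (0 : ℝ) < G := hα.trans_le hαG
  have hx : 0 < α / G := by positivity
  have hT' : (1 : ℝ) ≤ T := by exact_mod_cast hT
  refine ⟨fun s hs t ht hst => ?_, ?_⟩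
  · obtain ⟨t, rfl⟩ := Nat.exists_eq_add_of_le' (show 1 ≤ t by omega)
    have hsJ : (s : ℝ) ≤ CONES.lastJump f S x₀ t := by
      exact_mod_cast CONES.le_lastJump hs.2.2 (Nat.lt_succ_iff.1 hst)
    refine lt_of_le_of_lt ?_ (CONES.mul_lt_of_isJump hI hL hG0 huniq hs.1 hs.2.2
      (Nat.lt_succ_iff.1 hst) ht.2.1 ht.2.2)
    gcongr
  · have hlog : 0 ≤ Real.logb (1 + α / G) T := Real.logb_nonneg (by linarith) hT'
    have hceil : (0 : ℝ) ≤ ⌈(G : ℝ) / α⌉₊ := Nat.cast_nonneg _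
    rcases (CONES.frugalJumps f S x₀ T).eq_empty_or_nonempty with h0 | h0
    · rw [h0, Set.ncard_empty, Nat.cast_zero]
      linarith
    · have h1 := CONES.pow_ncard_frugalJumps_le hI hL hα hG0 huniq le_rfl h0
      have h2 : (CONES.lastJump f S x₀ T : ℝ) ≤ T := by exact_mod_cast CONES.lastJump_le T
      -- This already bounds the number of jumps by 1 plus the logarithm; the ceiling term enters
      -- only as nonnegative slack.
      have h3 : (((CONES.frugalJumps f S x₀ T).ncard - 1 : ℕ) : ℝ) ≤
          Real.logb (1 + α / G) T := by
        rw [Real.le_logb_iff_rpow_le (by linarith) (by linarith), Real.rpow_natCast]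
        exact h1.trans h2
      have h4 : ((CONES.frugalJumps f S x₀ T).ncard : ℝ) ≤
          (((CONES.frugalJumps f S x₀ T).ncard - 1 : ℕ) : ℝ) + 1 := by
        exact_mod_cast (by omega : (CONES.frugalJumps f S x₀ T).ncard ≤
          (CONES.frugalJumps f S x₀ T).ncard - 1 + 1)
      linarith
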